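/- **The algebra.** Let $\Theta$ be the set of all matrices $A=(a_{i,j})_{i,j\in\mathbb Z}$ over $\mathbb N$ with $a_{i+2,j+2}=a_{i,j}$, with finitely many nonzero entries in each row, and with $\sum_{i=1}^{2}\sum_{j\in\mathbb Z}a_{i,j}=\sum_{j=1}^{2}\sum_{i\in\mathbb Z}a_{i,j}=2$. Let $E_{i,j}$ be the matrix with entry $1$ at the places $(i+2s,j+2s)$, $s\in\mathbb Z$, and $0$ elsewhere; to $p,q\in\mathbb Z^2$ attach $M(p,q)=E_{p_1,q_1}+E_{p_2,q_2}\in\Theta$. Every element of $\Theta$ is of this form. The affine Schur algebra $S=S_\vartriangle(2,2)$ is the $\mathbb Q$-algebra with basis $\{e_A\mid A\in\Theta\}$ and multiplication $e_Ae_{A'}=\sum_{A''\in\Theta}c_{A,A',A''}\,e_{A''}$, where, for any $(p,q)$ with $M(p,q)=A''$, $c_{A,A',A''}=\#\{s\in\mathbb Z^2\mid M(p,s)=A,\ M(s,q)=A'\}$; its unit is the sum of the $e_{\mathrm{diag}(\lambda)}$ over the compositions $\lambda=(\lambda_1,\lambda_2)$ of $2$ (continued $2$-periodically). **Affine cellular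 algebras.** Let $k$ be a noetherian domain. A $k$-involution of a $k$-algebra is a $k$-linear anti-automorphism of square the identity; an affine $k$-algebra is a quotient of a polynomial ring over $k$ in finitely many variables. Let $A$ be a unital $k$-algebra with a $k$-involution $\tau$. A two-sided ideal $J$ of $A$ is an *affine cell ideal* if $\tau(J)=J$ and there are a free $k$-module $V$ of finite rank and an affine commutative $k$-algebra $B$ with a $k$-involution $\sigma$ such that * $\Delta=V\otimes_kB$ is an $A$-$B$-bimodule whose right $B$-structure comes from $B_B$; * there is an isomorphism of $A$-$A$-bimodules $\alpha:J\to\Delta\otimes_B\Delta'$, where $\Delta'=B\otimes_kV$ has the left $B$-structure of ${}_BB$ and the right $A$-structure $(b\otimes v)a=p\bigl(\tau(a)\,p^{-1}(b\otimes v)\bigr)$ for the switch map $p:\Delta\to\Delta'$, $p(v\otimes b)=\sigma(b)\otimes v$; * $\alpha\tau=f\alpha$ on $J$, where $f(v_1\otimes b_1\otimes b_2\otimes v_2)=v_2\otimes\sigma(b_2)\otimes\sigma(b_1)\otimes v_1$. A *cell chain* of $A$ is a chain of two-sided ideals $0=J_0\subset J_1\subset\dots\subset J_m=A$ for which there is a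 decomposition of $k$-modules $A=J_1'\oplus\dots\oplus J_m'$ with $\tau(J_l')=J_l'$ for all $l$ and $J_i=\bigoplus_{l\le i}J_l'$ for all $i$, and such that $J_i/J_{i-1}$ is an affine cell ideal of $A/J_{i-1}$ (with the induced involution) for $1\le i\le m$. The algebra $A$ is *affine cellular* (with respect to $\tau$) if it has a cell chain. **Theorem.** Let $\tau:S\to S$ be the linear map with $\tau(e_A)=e_{A^{t}}$, let $\lambda=(2,0)$, $e_\lambda=e_{\mathrm{diag}(\lambda)}$ and $J=Se_\lambda S$. Then: 1. $\tau$ is a $\mathbb Q$-involution and $S$ is affine cellular over $\mathbb Q$ with respect to $\tau$; more precisely $0\subsetneq J\subsetneq S$ is a cell chain of $S$. 2. $e_\lambda Se_\lambda\cong\mathbb Q[x_1,x_2,x_2^{-1}]$ as $\mathbb Q$-algebras, and $J$ is an affine cell ideal of $S$ with $B=e_\lambda Se_\lambda$, $\sigma=\tau|_B$ and some $V$ of rank four. 3. $S/J\cong\mathbb Q[x,x^{-1}]$ as $\mathbb Q$-algebras, and $S/J$ is affine cellular over $\mathbb Q$ with respect to the involution induced by $\tau$. -/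

import Mathlib

open scoped TensorProduct Polynomial LaurentPolynomial

noncomputable section

/-! ## Affine cellular algebras -/

section AffineCellular

universe u v

/-- A `k`-involution on a `k`-algebra: a `k`-linear anti-automorphism whose square is the
identity. (On a commutative algebra this is the same as a multiplicative `k`-linear map of
square the identity.) -/
structure IsInvolution {k : Type u} {A : Type v} [CommRing k] [Ring A] [Algebra k A]
    (τ : A →ₗ[k] A) : Prop where
  map_mul : ∀ a b, τ (a * b) = τ b * τ a
  apply_apply : ∀ a, τ (τ a) = a

/-- The switch map between the free `B`-module `Δ = V ⊗ B` on `V` and its dual version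
`Δ' = B ⊗ V`, twisted by the involution `σ` of `B`: it takes `v ⊗ b` to `σ b ⊗ v`. Because `B` is
commutative, right and left `B`-modules are the same, and both `Δ` and `Δ'` are written
`B ⊗[k] V`. For involutive `σ` it is its own inverse. -/
def switchMap {k B V : Type u} [CommRing k] [CommRing B] [Algebra k B]
    [AddCommGroup V] [Module k V] (σ : B →ₗ[k] B) : B ⊗[k] V →ₗ[k] B ⊗[k] V :=
  TensorProduct.map σ LinearMap.id

/-- `J` is an affine cell ideal of `A`, with respect to the `k`-involution `τ` of `A`, and this is
witnessed by the free `k`-module `V` of finite rank and the affine commutative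
`k`-algebra `B` with its involution `σ`.

* `ρ` is the left action of `A` on `Δ = V ⊗ B`, commuting with the action of `B`, so that `Δ` is an
  `A`-`B`-bimodule.
* `Δ' = B ⊗ V` has the right action `y · a = p (τ a · p⁻¹ y)` of `A`, where `p` is the
  (`σ`-twisted) switch map; here `p⁻¹ = p`.
* `α : J ≃ Δ ⊗_B Δ'` is an isomorphism of `A`-`A`-bimodules (this is stated for the inverse of `α`
  on pure tensors, which generate),
* `α` carries `τ` to `v₁ ⊗ b₁ ⊗ b₂ ⊗ v₂ ↦ v₂ ⊗ σ b₂ ⊗ σ b₁ ⊗ v₁`. -/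
structure IsAffineCellIdealWith {k : Type u} {A : Type v} [CommRing k] [Ring A] [Algebra k A]
    (τ : A →ₗ[k] A) (J : Ideal A) (V B : Type u) [AddCommGroup V] [Module k V]
    [CommRing B] [Algebra k B] (σ : B →ₗ[k] B) : Prop where
  isInvolution : IsInvolution τ
  isTwoSided : J.IsTwoSided
  map_eq : (J.restrictScalars k).map τ = J.restrictScalars k
  free : Module.Free k V
  finite : Module.Finite k V
  affine : Algebra.FiniteType k B
  isInvolution_base : IsInvolution σ
  exists_iso : ∃ (ρ : A →ₐ[k] Module.End B (B ⊗[k] V))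
    (α : J.restrictScalars k ≃ₗ[k] (B ⊗[k] V) ⊗[B] (B ⊗[k] V)),
    (∀ (a : A) (x y : B ⊗[k] V), (α.symm (ρ a x ⊗ₜ y) : A) = a * α.symm (x ⊗ₜ y)) ∧
    (∀ (a : A) (x y : B ⊗[k] V),
      (α.symm (x ⊗ₜ switchMap σ (ρ (τ a) (switchMap σ y))) : A) = α.symm (x ⊗ₜ y) * a) ∧
    (∀ (b₁ b₂ : B) (v₁ v₂ : V),
      τ (α.symm ((b₁ ⊗ₜ v₁) ⊗ₜ (b₂ ⊗ₜ v₂))) = α.symm ((σ b₂ ⊗ₜ v₂) ⊗ₜ (σ b₁ ⊗ₜ v₁)))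

/-- `J` is an affine cell ideal of `A` with respect to the involution `τ`. -/
def IsAffineCellIdeal {k : Type u} {A : Type v} [CommRing k] [Ring A] [Algebra k A]
    (τ : A →ₗ[k] A) (J : Ideal A) : Prop :=
  ∃ (V B : Type u) (_ : AddCommGroup V) (_ : Module k V) (_ : CommRing B) (_ : Algebra k B)
    (σ : B →ₗ[k] B), IsAffineCellIdealWith τ J V B σ

/-- `τ'` is the map that `τ` induces on the quotient of `A` by the two-sided ideal `I`. -/
def IsInducedOnQuotient {k : Type u} {A : Type v} [CommRing k] [Ring A] [Algebra k A]
    (τ : A →ₗ[k] A) (I : Ideal A) [I.IsTwoSided] (τ' : (A ⧸ I) →ₗ[k] (A ⧸ I)) : Prop :=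
  ∀ a, τ' (Ideal.Quotient.mk I a) = Ideal.Quotient.mk I (τ a)

/-- A cell chain of `A` with respect to `τ`: a chain `0 = J₀ ⊆ J₁ ⊆ ⋯ ⊆ Jₘ = A` of two-sided
ideals that comes from a decomposition of the `k`-module `A` into `τ`-stable submodules
`J'₁ ⊕ ⋯ ⊕ J'ₘ` through `Jᵢ = J'₁ ⊕ ⋯ ⊕ J'ᵢ`, and all of whose layers `Jᵢ / Jᵢ₋₁` are affine cell
ideals of `A / Jᵢ₋₁` with respect to the induced involution. -/
structure IsAffineCellChain {k : Type u} {A : Type v} [CommRing k] [Ring A] [Algebra k A]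
    (τ : A →ₗ[k] A) {m : ℕ} (J : Fin (m + 1) → Ideal A) : Prop where
  isTwoSided : ∀ i, (J i).IsTwoSided
  decomposition : ∃ J' : Fin m → Submodule k A, DirectSum.IsInternal J' ∧
    (∀ l, (J' l).map τ = J' l) ∧
    (∀ i, (J i).restrictScalars k = ⨆ (l : Fin m) (_ : l.castSucc < i), J' l)
  layers : ∀ i : Fin m, letI := isTwoSided i.castSucc
    ∃ τ' : (A ⧸ J i.castSucc) →ₗ[k] (A ⧸ J i.castSucc), IsInducedOnQuotient τ (J i.castSucc) τ' ∧
      IsAffineCellIdeal τ' ((J i.succ).map (Ideal.Quotient.mk (J i.castSucc)))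

/-- The `k`-algebra `A` with the `k`-involution `τ` is affine cellular. -/
def IsAffineCellular {k : Type u} {A : Type v} [CommRing k] [Ring A] [Algebra k A]
    (τ : A →ₗ[k] A) : Prop :=
  IsInvolution τ ∧ ∃ (m : ℕ) (J : Fin (m + 1) → Ideal A), IsAffineCellChain τ J

/-- The two-sided ideal `A e A` generated by `e`: all sums of products `a e b`. -/
def idealGeneratedBy {A : Type v} [Ring A] (e : A) : Ideal A :=
  Ideal.span {x | ∃ a b, x = a * e * b}

instance idealGeneratedBy_isTwoSided {A : Type v} [Ring A] (e : A) :
    (idealGeneratedBy e).IsTwoSided where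
  mul_mem_of_left := by
    intro x c hx
    refine Submodule.span_induction (p := fun x _ => x * c ∈ idealGeneratedBy e)
      ?_ ?_ ?_ ?_ hx
    · rintro _ ⟨a, b, rfl⟩
      exact Ideal.subset_span ⟨a, b * c, by simp only [mul_assoc]⟩
    · simp
    · intro x y _ _ h1 h2
      rw [add_mul]
      exact add_mem h1 h2
    · intro a x _ h
      rw [smul_eq_mul, mul_assoc]
      exact Ideal.mul_mem_left _ a h

end AffineCellular

/-! ## The affine Schur algebra -/

namespace AffineSchur

/-- The set `I(ℤ, r)` of `r`-tuples of integers. -/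
abbrev Tuple (r : ℕ) : Type := Fin r → ℤ

open Classical in
/-- The periodic matrix `E_{i,j}`: it has the entry `1` at the places `(i + s n, j + s n)`, `s ∈ ℤ`,
and the entry `0` elsewhere. -/
def E (n : ℕ) (i j : ℤ) (x y : ℤ) : ℕ :=
  if ∃ s : ℤ, x = i + s * n ∧ y = j + s * n then 1 else 0

/-- The set `Θ(n, r)` of all `ℤ × ℤ` matrices over `ℕ` which are `n`-periodic along the diagonal,
have finitely many nonzero entries in each row, and whose entries in the rows `1, …, n`, as well as
those in the columns `1, …, n`, add up to `r`. -/
@[ext] structure Theta (n r : ℕ) where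
  entry : ℤ → ℤ → ℕ
  periodic : ∀ i j, entry (i + n) (j + n) = entry i j
  finite_row : ∀ i, {j | entry i j ≠ 0}.Finite
  sum_rows : ∑ i ∈ Finset.Icc (1 : ℤ) n, ∑ᶠ j, entry i j = r
  sum_cols : ∑ j ∈ Finset.Icc (1 : ℤ) n, ∑ᶠ i, entry i j = r

/-- The entries of the matrix `∑ₜ E_{iₜ, jₜ}` of a pair `(i, j)` of `r`-tuples. -/
def pairEntry (n : ℕ) {r : ℕ} (i j : Tuple r) (x y : ℤ) : ℕ := ∑ t, E n (i t) (j t) x y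

/-- Two pairs of `r`-tuples are in the same orbit of the extended affine Weyl group
`𝔖ᵣ ⋉ ℤʳ`, which acts by place permutations and by shifts by multiples of `n`, diagonally on
pairs. -/
def SameOrbit (n : ℕ) {r : ℕ} (i j k l : Tuple r) : Prop :=
  ∃ (w : Equiv.Perm (Fin r)) (ε : Fin r → ℤ),
    ∀ t, k t = i (w t) + n * ε t ∧ l t = j (w t) + n * ε t


section Combinatorics

theorem E_eq (n : ℕ) (i j x y : ℤ) :
    E n i j x y = if (n : ℤ) ∣ x - i ∧ y = j + (x - i) then 1 else 0 := by
  unfold E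
  congr 1
  refine propext ⟨?_, ?_⟩
  · rintro ⟨s, rfl, rfl⟩
    exact ⟨⟨s, by ring⟩, by ring⟩
  · rintro ⟨⟨s, hs⟩, rfl⟩
    exact ⟨s, by linarith, by linarith⟩

theorem E_swap (n : ℕ) (i j x y : ℤ) : E n i j x y = E n j i y x := by
  unfold E
  congr 1
  exact propext (exists_congr fun s => and_comm)

theorem E_ne_zero {n : ℕ} {i j x y : ℤ} (h : E n i j x y ≠ 0) :
    (n : ℤ) ∣ x - i ∧ y = j + (x - i) := by
  rw [E_eq] at h
  by_contra hc
  exact h (if_neg hc)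

theorem E_self (n : ℕ) (i j : ℤ) : E n i j i j = 1 := by
  rw [E_eq, if_pos]
  simp

theorem pairEntry_swap (n : ℕ) {r : ℕ} (i j : Tuple r) (x y : ℤ) :
    pairEntry n i j x y = pairEntry n j i y x := by
  unfold pairEntry
  exact Finset.sum_congr rfl fun t _ => E_swap n _ _ _ _

theorem pairEntry_ne_zero {n r : ℕ} {i j : Tuple r} {x y : ℤ} (h : pairEntry n i j x y ≠ 0) :
    ∃ t, (n : ℤ) ∣ x - i t ∧ y = j t + (x - i t) := by
  obtain ⟨t, -, ht⟩ := Finset.exists_ne_zero_of_sum_ne_zero h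
  exact ⟨t, E_ne_zero ht⟩

theorem pairEntry_self_ne_zero (n : ℕ) {r : ℕ} (i j : Tuple r) (t : Fin r) :
    pairEntry n i j (i t) (j t) ≠ 0 := by
  have h : E n (i t) (j t) (i t) (j t) ≤ pairEntry n i j (i t) (j t) :=
    Finset.single_le_sum (f := fun s => E n (i s) (j s) (i t) (j t))
      (fun _ _ => Nat.zero_le _) (Finset.mem_univ t)
  rw [E_self] at h
  omega

theorem finite_row_pairEntry (n : ℕ) {r : ℕ} (i j : Tuple r) (x : ℤ) :
    {y | pairEntry n i j x y ≠ 0}.Finite := by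
  refine (Set.finite_range fun t => j t + (x - i t)).subset ?_
  intro y hy
  obtain ⟨t, -, h⟩ := pairEntry_ne_zero hy
  exact ⟨t, h.symm⟩

theorem sum_dvd (n : ℕ) [NeZero n] (i : ℤ) :
    ∑ x ∈ Finset.Icc (1 : ℤ) n, (if (n : ℤ) ∣ x - i then 1 else 0) = 1 := by
  have hn : (0 : ℤ) < n := by exact_mod_cast Nat.pos_of_ne_zero (NeZero.ne n)
  have h1 := Int.emod_nonneg (i - 1) hn.ne'
  have h2 := Int.emod_lt_of_pos (i - 1) hn
  have h3 := Int.emod_add_mul_ediv (i - 1) n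
  rw [Finset.sum_eq_single ((i - 1) % n + 1)]
  · rw [if_pos]
    exact ⟨-((i - 1) / n), by linarith⟩
  · intro x hx hne
    rw [if_neg]
    rintro ⟨c, hc⟩
    apply hne
    rw [Finset.mem_Icc] at hx
    have : (x - 1) % n = (i - 1) % n := by
      apply Int.emod_emod_of_dvd _ (dvd_refl _) |>.symm.trans
      rw [show x - 1 = i - 1 + n * c by linarith, Int.add_mul_emod_self_left, Int.emod_emod]
    rw [Int.emod_eq_of_lt (by linarith) (by linarith)] at this
    linarith
  · intro h
    exact absurd (Finset.mem_Icc.2 ⟨by linarith, by linarith⟩) h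

theorem finsum_E (n : ℕ) (i j x : ℤ) :
    ∑ᶠ y, E n i j x y = if (n : ℤ) ∣ x - i then 1 else 0 := by
  rw [finsum_eq_single _ (j + (x - i))]
  · simp [E_eq]
  · intro y hy
    by_contra h
    exact hy (E_ne_zero h).2

theorem sum_rows_pairEntry (n : ℕ) [NeZero n] {r : ℕ} (i j : Tuple r) :
    ∑ x ∈ Finset.Icc (1 : ℤ) n, ∑ᶠ y, pairEntry n i j x y = r := by
  have h : ∀ x, ∑ᶠ y, pairEntry n i j x y =
      ∑ t, (if (n : ℤ) ∣ x - i t then 1 else 0) := by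
    intro x
    unfold pairEntry
    rw [finsum_sum_comm]
    · simp only [finsum_E]
    · intro t _
      refine (Set.finite_singleton (j t + (x - i t))).subset ?_
      intro y hy
      exact (E_ne_zero hy).2
  simp only [h]
  rw [Finset.sum_comm, Finset.sum_congr rfl fun t _ => sum_dvd n (i t)]
  simp

theorem periodic_pairEntry (n : ℕ) {r : ℕ} (i j : Tuple r) (x y : ℤ) :
    pairEntry n i j (x + n) (y + n) = pairEntry n i j x y := by
  unfold pairEntry
  refine Finset.sum_congr rfl fun t _ => ?_
  rw [E_eq, E_eq]
  have h1 : (n : ℤ) ∣ x + n - i t ↔ (n : ℤ) ∣ x - i t := by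
    rw [show x + n - i t = x - i t + n by ring]
    exact dvd_add_self_right
  have h2 : y + n = j t + (x + n - i t) ↔ y = j t + (x - i t) := by
    constructor <;> intro h <;> linarith
  simp only [h1, h2]

/-- The matrix in `Θ(n, r)` of a pair of `r`-tuples. -/
def ofPair (n : ℕ) [NeZero n] {r : ℕ} (i j : Tuple r) : Theta n r where
  entry := pairEntry n i j
  periodic := periodic_pairEntry n i j
  finite_row := finite_row_pairEntry n i j
  sum_rows := sum_rows_pairEntry n i j
  sum_cols := by
    simp only [pairEntry_swap n i j]
    exact sum_rows_pairEntry n j i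

theorem Theta.periodic_mul {n r : ℕ} (A : Theta n r) (i j s : ℤ) :
    A.entry (i + s * n) (j + s * n) = A.entry i j := by
  induction s using Int.induction_on with
  | zero => simp
  | succ k ih =>
    rw [← ih, ← A.periodic (i + k * n)]
    congr 1 <;> ring
  | pred k ih =>
    rw [← ih, ← A.periodic (i + (-k - 1) * n)]
    congr 1 <;> ring

/-- Every matrix in `Θ(n, r)` is the matrix of a pair of `r`-tuples. -/
theorem exists_ofPair {n : ℕ} [NeZero n] {r : ℕ} (A : Theta n r) :
    ∃ i j : Tuple r, ofPair n i j = A := by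
  classical
  have hn : (0 : ℤ) < n := by exact_mod_cast Nat.pos_of_ne_zero (NeZero.ne n)
  let F : ℤ → Finset ℤ := fun x => (A.finite_row x).toFinset
  let T := Σ (x : Finset.Icc (1 : ℤ) n) (y : F x), Fin (A.entry x y)
  have hsum : ∀ g : ℤ → ℤ → ℕ, ∑ t : T, g t.1 t.2.1 =
      ∑ x ∈ Finset.Icc (1 : ℤ) n, ∑ y ∈ F x, A.entry x y * g x y := by
    intro g
    rw [Fintype.sum_sigma,
      ← Finset.sum_coe_sort _ fun x => ∑ y ∈ F x, A.entry x y * g x y]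
    refine Finset.sum_congr rfl fun x _ => ?_
    rw [Fintype.sum_sigma, ← Finset.sum_coe_sort _ fun y => A.entry x y * g x y]
    refine Finset.sum_congr rfl fun y _ => ?_
    simp
  have hcard : Fintype.card T = r := by
    have h := hsum fun _ _ => 1
    simp only [Finset.sum_const, Finset.card_univ, smul_eq_mul, mul_one] at h
    refine h.trans (Eq.trans ?_ A.sum_rows)
    refine Finset.sum_congr rfl fun x _ => ?_
    rw [finsum_eq_sum_of_support_subset]
    intro y hy
    simpa [F] using hy
  let e : Fin r ≃ T := (Fintype.equivFinOfCardEq hcard).symm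
  refine ⟨fun t => (e t).1, fun t => (e t).2.1, ?_⟩
  ext x' y'
  change ∑ t, E n (e t).1 (e t).2.1 x' y' = _
  rw [e.sum_comp fun t : T => E n t.1 t.2.1 x' y', hsum fun x y => E n x y x' y']
  have h1 := Int.emod_nonneg (x' - 1) hn.ne'
  have h2 := Int.emod_lt_of_pos (x' - 1) hn
  have h3 := Int.emod_add_mul_ediv (x' - 1) n
  set q := (x' - 1) / n with hq
  have key : ∀ x ∈ Finset.Icc (1 : ℤ) n, ∀ y, E n x y x' y' ≠ 0 →
      x = x' - q * n ∧ y = y' - q * n := by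
    intro x hx y h
    rw [Finset.mem_Icc] at hx
    obtain ⟨⟨c, hc⟩, h'⟩ := E_ne_zero h
    have : q = c := by
      rw [hq, show x' - 1 = x - 1 + n * c by linarith, Int.add_mul_ediv_left _ _ hn.ne',
        Int.ediv_eq_zero_of_lt (by linarith) (by linarith), zero_add]
    subst this
    constructor <;> linarith
  have hE : E n (x' - q * n) (y' - q * n) x' y' = 1 := by
    rw [E_eq, if_pos]
    exact ⟨⟨q, by ring⟩, by ring⟩
  rw [Finset.sum_eq_single (x' - q * n)]
  · rw [Finset.sum_eq_single (y' - q * n)]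
    · rw [hE, mul_one, ← A.periodic_mul _ _ q]
      simp
    · intro y hy hne
      by_contra h
      refine hne (key _ ?_ y (right_ne_zero_of_mul h)).2
      exact Finset.mem_Icc.2 ⟨by linarith, by linarith⟩
    · intro h
      have : A.entry (x' - q * n) (y' - q * n) = 0 := by simpa [F] using h
      rw [this, zero_mul]
  · intro x hx hne
    refine Finset.sum_eq_zero fun y _ => ?_
    by_contra h
    exact hne (key x hx y (right_ne_zero_of_mul h)).1
  · intro h
    exact absurd (Finset.mem_Icc.2 ⟨by linarith, by linarith⟩) h

theorem SameOrbit.ofPair_eq {n : ℕ} [NeZero n] {r : ℕ} {i j k l : Tuple r}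
    (h : SameOrbit n i j k l) : ofPair n i j = ofPair n k l := by
  obtain ⟨w, ε, h⟩ := h
  ext x y
  change ∑ t, E n (i t) (j t) x y = ∑ t, E n (k t) (l t) x y
  rw [← Equiv.sum_comp w]
  refine Finset.sum_congr rfl fun t _ => ?_
  rw [E_eq, E_eq, (h t).1, (h t).2]
  have h1 : (n : ℤ) ∣ x - (i (w t) + n * ε t) ↔ (n : ℤ) ∣ x - i (w t) := by
    rw [← sub_sub]
    exact dvd_sub_left (dvd_mul_right _ _)
  have h2 : j (w t) + n * ε t + (x - (i (w t) + n * ε t)) = j (w t) + (x - i (w t)) := by ring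
  simp only [h1, h2]

/-- Two pairs have the same matrix if and only if they lie in the same orbit. -/
theorem ofPair_eq_iff {n : ℕ} [NeZero n] {r : ℕ} {i j k l : Tuple r} :
    ofPair n i j = ofPair n k l ↔ SameOrbit n i j k l := by
  classical
  refine ⟨fun h => ?_, SameOrbit.ofPair_eq⟩
  let κ : ℤ → ℤ → ℤ × ℤ := fun x y => (x % n, y - x)
  have hκ : ∀ a b x y, E n a b x y = if κ a b = κ x y then 1 else 0 := by
    intro a b x y
    rw [E_eq]
    congr 1
    rw [eq_iff_iff, Prod.mk.injEq, ← Int.ModEq, Int.modEq_iff_dvd]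
    refine and_congr Iff.rfl ?_
    constructor <;> intro h <;> linarith
  have hc : ∀ c : ℤ × ℤ, Fintype.card {t // κ (k t) (l t) = c} =
      Fintype.card {t // κ (i t) (j t) = c} := by
    intro c
    have aux : ∀ i j : Tuple r, ∀ x y, Fintype.card {t // κ (i t) (j t) = κ x y} =
        pairEntry n i j x y := by
      intro i j x y
      rw [Fintype.card_subtype, pairEntry]
      simp only [hκ]
      rw [Finset.sum_boole, Nat.cast_id]
    by_cases hx : ∃ x y, κ x y = c
    · obtain ⟨x, y, rfl⟩ := hx
      rw [aux, aux]
      exact (congrFun (congrFun (congrArg Theta.entry h) x) y).symm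
    · have : ∀ i j : Tuple r, Fintype.card {t // κ (i t) (j t) = c} = 0 := by
        intro i j
        rw [Fintype.card_eq_zero_iff]
        exact ⟨fun t => hx ⟨_, _, t.2⟩⟩
      rw [this, this]
  let w : Equiv.Perm (Fin r) := Equiv.ofFiberEquiv (f := fun t => κ (k t) (l t))
    (g := fun t => κ (i t) (j t)) fun c => Fintype.equivOfCardEq (hc c)
  have hw : ∀ t, κ (i (w t)) (j (w t)) = κ (k t) (l t) := fun t =>
    Equiv.ofFiberEquiv_map (f := fun t => κ (k t) (l t)) (g := fun t => κ (i t) (j t)) _ t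
  have hd : ∀ t, ∃ s : ℤ, k t = i (w t) + n * s ∧ l t = j (w t) + n * s := by
    intro t
    have h := hw t
    rw [Prod.mk.injEq, ← Int.ModEq, Int.modEq_iff_dvd] at h
    obtain ⟨⟨s, hs⟩, h2⟩ := h
    exact ⟨s, by linarith, by linarith⟩
  choose ε hε using hd
  exact ⟨w, ε, hε⟩

/-- For a fixed tuple `p` there are only finitely many tuples `q` such that `(p, q)` has a given
matrix. -/
theorem finite_right {n : ℕ} [NeZero n] {r : ℕ} (p : Tuple r) (A : Theta n r) :
    {q | ofPair n p q = A}.Finite := by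
  refine (Set.Finite.pi' fun t => A.finite_row (p t)).subset ?_
  rintro q rfl t
  exact pairEntry_self_ne_zero n p q t

/-- The transpose of a matrix in `Θ(n, r)`. -/
def transpose {n : ℕ} [NeZero n] {r : ℕ} (A : Theta n r) : Theta n r where
  entry x y := A.entry y x
  periodic i j := A.periodic j i
  finite_row i := by
    obtain ⟨p, q, rfl⟩ := exists_ofPair A
    refine (finite_row_pairEntry n q p i).subset ?_
    intro y hy
    change pairEntry n q p i y ≠ 0
    rw [← pairEntry_swap]
    exact hy
  sum_rows := A.sum_cols
  sum_cols := A.sum_rows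

theorem transpose_ofPair {n : ℕ} [NeZero n] {r : ℕ} (p q : Tuple r) :
    transpose (ofPair n p q) = ofPair n q p := by
  ext x y
  exact pairEntry_swap n p q y x

theorem finite_left {n : ℕ} [NeZero n] {r : ℕ} (q : Tuple r) (A : Theta n r) :
    {p | ofPair n p q = A}.Finite := by
  refine (finite_right q (transpose A)).subset ?_
  rintro p rfl
  exact (transpose_ofPair p q).symm

end Combinatorics

section Algebra

variable (n r : ℕ) [NeZero n]

/-- The set `Λ(n, r)` of compositions `λ = (λ₁, …, λₙ)` of `r`; the entry `λᵢ` is the value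
at `i - 1 : Fin n`. -/
abbrev Composition : Type := {l : Fin n → ℕ // l ∈ Finset.piAntidiag Finset.univ r}

variable {n r}

/-- The element of `Fin n` that corresponds to the index `x ∈ ℤ`, so that `x = 1, …, n`
correspond to `0, …, n - 1`, and the result only depends on `x` modulo `n`. -/
def residue (n : ℕ) [NeZero n] (x : ℤ) : Fin n :=
  ⟨((x - 1) % n).toNat, by
    have hn : (0 : ℤ) < n := by exact_mod_cast Nat.pos_of_ne_zero (NeZero.ne n)
    have h1 := Int.emod_nonneg (x - 1) hn.ne'
    have h2 := Int.emod_lt_of_pos (x - 1) hn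
    omega⟩

theorem residue_add (x : ℤ) : residue n (x + n) = residue n x := by
  unfold residue
  congr 2
  rw [show x + (n : ℤ) - 1 = x - 1 + n by ring, Int.add_emod_right]

theorem sum_residue (l : Fin n → ℕ) :
    ∑ x ∈ Finset.Icc (1 : ℤ) n, l (residue n x) = ∑ c, l c := by
  refine Finset.sum_bij' (fun x _ => residue n x) (fun c _ => ((c : ℕ) : ℤ) + 1)
    (fun _ _ => Finset.mem_univ _) ?_ ?_ ?_ fun _ _ => rfl
  · intro c _
    have := c.2
    rw [Finset.mem_Icc]
    omega
  · intro x hx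
    rw [Finset.mem_Icc] at hx
    have h : (x - 1) % (n : ℤ) = x - 1 := Int.emod_eq_of_lt (by omega) (by omega)
    simp only [residue, h]
    omega
  · intro c _
    have h : ((c : ℕ) : ℤ) % (n : ℤ) = (c : ℕ) :=
      Int.emod_eq_of_lt (by omega) (by have := c.2; omega)
    ext
    simp [residue, h]

theorem finsum_diag (x : ℤ) (a : ℤ → ℕ) : ∑ᶠ y, (if x = y then a x else 0) = a x := by
  rw [finsum_eq_single _ x]
  · simp
  · intro y hy
    exact if_neg hy.symm

/-- The diagonal matrix `diag(λ)` with the entries `λᵢ`, continued periodically. -/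
def diag (l : Composition n r) : Theta n r where
  entry x y := if x = y then l.1 (residue n x) else 0
  periodic i j := by simp [residue_add]
  finite_row i := by
    refine (Set.finite_singleton i).subset ?_
    intro y hy
    by_contra h
    exact hy (if_neg fun h' => h h'.symm)
  sum_rows := by
    simp only [finsum_diag _ fun x => l.1 (residue n x)]
    rw [sum_residue]
    exact (Finset.mem_piAntidiag.1 l.2).1
  sum_cols := by
    have h : ∀ x y : ℤ, (if x = y then l.1 (residue n x) else 0) =
        if y = x then l.1 (residue n y) else 0 := by
      intro x y
      by_cases h : x = y
      · subst h
        rfl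
      · rw [if_neg h, if_neg fun h' => h h'.symm]
    simp only [h, finsum_diag _ fun x => l.1 (residue n x)]
    rw [sum_residue]
    exact (Finset.mem_piAntidiag.1 l.2).1

/-- A pair `(p, q)` of `r`-tuples that represents the matrix `A`. -/
def rep (A : Theta n r) : Tuple r × Tuple r :=
  ((exists_ofPair A).choose, (exists_ofPair A).choose_spec.choose)

theorem ofPair_rep (A : Theta n r) : ofPair n (rep A).1 (rep A).2 = A :=
  (exists_ofPair A).choose_spec.choose_spec

/-- The structure constants of the affine Schur algebra: for any pair `(p, q)` of `r`-tuples with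
matrix `C`, the number of all `s ∈ I(ℤ, r)` such that `(p, s)` has the matrix `A` and `(s, q)` has
the matrix `B`. This does not depend on the choice of `(p, q)`, see `structureConst_eq`. -/
def structureConst (A B C : Theta n r) : ℕ :=
  {s : Tuple r | ofPair n (rep C).1 s = A ∧ ofPair n s (rep C).2 = B}.ncard

theorem ncard_eq_of_sameOrbit {i j k l : Tuple r} (h : SameOrbit n i j k l) (A B : Theta n r) :
    {s : Tuple r | ofPair n i s = A ∧ ofPair n s j = B}.ncard =
      {s : Tuple r | ofPair n k s = A ∧ ofPair n s l = B}.ncard := by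
  obtain ⟨w, ε, h⟩ := h
  let φ : Tuple r → Tuple r := fun s t => s (w t) + n * ε t
  have hφ : Function.Injective φ := by
    intro s s' hs
    funext t
    have := congrFun hs (w.symm t)
    simpa [φ] using this
  have h1 : ∀ s, ofPair n k (φ s) = ofPair n i s := fun s =>
    (SameOrbit.ofPair_eq ⟨w, ε, fun t => ⟨(h t).1, rfl⟩⟩).symm
  have h2 : ∀ s, ofPair n (φ s) l = ofPair n s j := fun s =>
    (SameOrbit.ofPair_eq ⟨w, ε, fun t => ⟨rfl, (h t).2⟩⟩).symm
  rw [← Set.ncard_image_of_injective _ hφ]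
  congr 1
  ext s
  constructor
  · rintro ⟨s, ⟨rfl, rfl⟩, rfl⟩
    exact ⟨h1 s, h2 s⟩
  · rintro ⟨rfl, rfl⟩
    have hs : φ (fun t => s (w.symm t) - n * ε (w.symm t)) = s := by
      funext t
      simp [φ]
    refine ⟨fun t => s (w.symm t) - n * ε (w.symm t), ⟨?_, ?_⟩, hs⟩
    · rw [← h1, hs]
    · rw [← h2, hs]

theorem structureConst_eq (A B : Theta n r) (p q : Tuple r) :
    structureConst A B (ofPair n p q) =
      {s : Tuple r | ofPair n p s = A ∧ ofPair n s q = B}.ncard :=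
  ncard_eq_of_sameOrbit (ofPair_eq_iff.1 (ofPair_rep _)) A B

theorem finite_structureConst (A B : Theta n r) :
    {C | structureConst A B C ≠ 0}.Finite := by
  obtain ⟨p, s₀, hA⟩ := exists_ofPair A
  refine ((((finite_right p A).biUnion fun s _ => finite_right s B)).image (ofPair n p)).subset ?_
  intro C hC
  obtain ⟨s, hs1, hs2⟩ := Set.nonempty_of_ncard_ne_zero hC
  have hC' := ofPair_rep C
  obtain ⟨w, ε, h⟩ := ofPair_eq_iff.1 (hs1.trans hA.symm)
  have h1 : ofPair n p (fun t => (rep C).2 (w t) + n * ε t) = C := by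
    refine Eq.trans (SameOrbit.ofPair_eq ⟨w, ε, fun t => ⟨(h t).1, rfl⟩⟩).symm hC'
  refine ⟨fun t => (rep C).2 (w t) + n * ε t, ?_, h1⟩
  refine Set.mem_biUnion (x := fun t => s (w t) + n * ε t) ?_ ?_
  · refine Eq.trans (SameOrbit.ofPair_eq ⟨w, ε, fun t => ⟨(h t).1, rfl⟩⟩).symm hs1
  · refine Eq.trans (SameOrbit.ofPair_eq ⟨w, ε, fun t => ⟨rfl, rfl⟩⟩).symm hs2

end Algebra

end AffineSchur

/-- The affine Schur algebra `S(n, r)` over `ℚ`, as a vector space: its basis `e_A` is indexed by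
the matrices `A ∈ Θ(n, r)`. -/
def AffineSchur (n r : ℕ) : Type := AffineSchur.Theta n r →₀ ℚ

namespace AffineSchur

section Ring

variable {n r : ℕ}

instance : AddCommGroup (AffineSchur n r) := inferInstanceAs (AddCommGroup (Theta n r →₀ ℚ))

instance : Module ℚ (AffineSchur n r) := inferInstanceAs (Module ℚ (Theta n r →₀ ℚ))

/-- The basis of the affine Schur algebra. -/
def basis (n r : ℕ) : Module.Basis (Theta n r) ℚ (AffineSchur n r) :=
  Module.Basis.ofRepr (LinearEquiv.refl ℚ (Theta n r →₀ ℚ))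

/-- The basis element `e_A`. -/
def e (A : Theta n r) : AffineSchur n r := basis n r A

variable [NeZero n]

/-- The product `e_A e_B = ∑_C c(A, B, C) e_C` of two basis elements. -/
def mulBasis (A B : Theta n r) : AffineSchur n r :=
  ∑ C ∈ (finite_structureConst A B).toFinset, (structureConst A B C : ℚ) • e C

/-- The multiplication of the affine Schur algebra, the bilinear extension of the product of the
basis elements. -/
def mulLin : AffineSchur n r →ₗ[ℚ] AffineSchur n r →ₗ[ℚ] AffineSchur n r :=
  (basis n r).constr ℚ fun A => (basis n r).constr ℚ fun B => mulBasis A B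

instance : Mul (AffineSchur n r) := ⟨fun f g => mulLin f g⟩

/-- The unit element, the sum of the elements `e_λ = e_{diag(λ)}` over all compositions `λ`. -/
instance : One (AffineSchur n r) := ⟨∑ l : Composition n r, e (diag l)⟩

theorem e_mul_e (A B : Theta n r) : e A * e B = mulBasis A B := by
  change mulLin (basis n r A) (basis n r B) = _
  rw [mulLin, Module.Basis.constr_basis, Module.Basis.constr_basis]

theorem repr_mulBasis (A B C : Theta n r) :
    (basis n r).repr (mulBasis A B) C = structureConst A B C := by
  classical
  unfold mulBasis e
  simp only [map_sum, map_smul, Module.Basis.repr_self, Finsupp.finsetSum_apply,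
    Finsupp.smul_apply, Finsupp.single_apply, smul_eq_mul, mul_ite, mul_one, mul_zero]
  rw [Finset.sum_ite_eq']
  split_ifs with h
  · rfl
  · simp only [Set.Finite.mem_toFinset, Set.mem_ofPred_eq, not_not] at h
    simp [h]

/-- The operator on the free vector space on `I(ℤ, r)` by which `e_A` acts; it is used to prove
that the multiplication is associative. -/
def op (A : Theta n r) : (Tuple r →₀ ℚ) →ₗ[ℚ] (Tuple r →₀ ℚ) :=
  Finsupp.linearCombination ℚ fun q =>
    ∑ p ∈ (finite_left q A).toFinset, Finsupp.single p (1 : ℚ)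

theorem op_apply (A : Theta n r) (p q : Tuple r) [Decidable (ofPair n p q = A)] :
    op A (Finsupp.single q 1) p = if ofPair n p q = A then 1 else 0 := by
  classical
  simp [op, Finsupp.linearCombination_single, Finsupp.finsetSum_apply, Finsupp.single_apply]

/-- The action of the affine Schur algebra on the free vector space on `I(ℤ, r)`. -/
def act : AffineSchur n r →ₗ[ℚ] Module.End ℚ (Tuple r →₀ ℚ) := (basis n r).constr ℚ op

theorem act_e (A : Theta n r) : act (e A) = op A := (basis n r).constr_basis ℚ _ A

theorem act_apply (f : AffineSchur n r) (p q : Tuple r) :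
    act f (Finsupp.single q 1) p = (basis n r).repr f (ofPair n p q) := by
  classical
  have h : Finsupp.lapply p ∘ₗ LinearMap.applyₗ (Finsupp.single q (1 : ℚ)) ∘ₗ
      (act (n := n) (r := r)) = Finsupp.lapply (ofPair n p q) ∘ₗ (basis n r).repr.toLinearMap := by
    refine (basis n r).ext fun A => ?_
    change act (e A) _ _ = (basis n r).repr (basis n r A) (ofPair n p q)
    rw [act_e, op_apply, Module.Basis.repr_self, Finsupp.single_apply]
    simp only [eq_comm]
  exact LinearMap.congr_fun h f

theorem act_injective : Function.Injective (act : AffineSchur n r → _) := by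
  intro f g h
  apply (basis n r).repr.injective
  ext A
  obtain ⟨p, q, rfl⟩ := exists_ofPair A
  rw [← act_apply, ← act_apply, h]

theorem op_mul_op (A B : Theta n r) : op A * op B = act (mulBasis A B) := by
  classical
  refine Finsupp.lhom_ext' fun q => LinearMap.ext_ring ?_
  ext p
  simp only [LinearMap.coe_comp, Function.comp_apply, Finsupp.lsingle_apply]
  rw [act_apply, repr_mulBasis, structureConst_eq, Module.End.mul_apply]
  have h : op B (Finsupp.single q 1) =
      ∑ s ∈ (finite_left q B).toFinset, Finsupp.single s (1 : ℚ) := by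
    simp [op, Finsupp.linearCombination_single]
  rw [h, map_sum, Finsupp.finsetSum_apply]
  simp only [op_apply]
  rw [Finset.sum_boole, Set.ncard_eq_toFinset_card _
    ((finite_left q B).subset fun s hs => hs.2)]
  congr 2
  ext s
  simp [and_comm]

theorem act_mul (f g : AffineSchur n r) : act (f * g) = act f * act g := by
  have h : mulLin.compr₂ act = (LinearMap.mul ℚ (Module.End ℚ (Tuple r →₀ ℚ))).compl₁₂
      (act (n := n) (r := r)) act := by
    refine (basis n r).ext fun A => (basis n r).ext fun B => ?_
    change act (e A * e B) = act (e A) * act (e B)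
    rw [e_mul_e, act_e, act_e, op_mul_op]
  exact LinearMap.congr_fun (LinearMap.congr_fun h f) g

theorem residue_succ (c : Fin n) : residue n (((c : ℕ) : ℤ) + 1) = c := by
  have h : ((c : ℕ) : ℤ) % (n : ℤ) = (c : ℕ) :=
    Int.emod_eq_of_lt (by omega) (by have := c.2; omega)
  ext
  simp [residue, h]

theorem diag_injective : Function.Injective (diag : Composition n r → Theta n r) := by
  intro l l' h
  ext c
  have := congrFun (congrFun (congrArg Theta.entry h) (((c : ℕ) : ℤ) + 1)) (((c : ℕ) : ℤ) + 1)
  simpa [diag, residue_succ] using this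

theorem exists_diag (p : Tuple r) : ∃ l : Composition n r, ofPair n p p = diag l := by
  have hn : (0 : ℤ) < n := by exact_mod_cast Nat.pos_of_ne_zero (NeZero.ne n)
  let a : Fin n → ℕ := fun c => pairEntry n p p (((c : ℕ) : ℤ) + 1) (((c : ℕ) : ℤ) + 1)
  have h1 : ∀ x, pairEntry n p p x x = a (residue n x) := by
    intro x
    have h2 := Int.emod_nonneg (x - 1) hn.ne'
    have h3 := Int.emod_add_mul_ediv (x - 1) n
    have h4 : x = (((residue n x : ℕ) : ℤ) + 1) + (x - 1) / n * n := by
      simp only [residue]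
      rw [Int.toNat_of_nonneg h2]
      linarith
    exact (congrArg (fun y => pairEntry n p p y y) h4).trans
      ((ofPair n p p).periodic_mul (((residue n x : ℕ) : ℤ) + 1) _ _)
  have h5 : ∀ x y, pairEntry n p p x y = if x = y then a (residue n x) else 0 := by
    intro x y
    split_ifs with h
    · rw [← h, h1]
    · by_contra hc
      obtain ⟨t, -, ht⟩ := pairEntry_ne_zero hc
      exact h (by linarith)
  have h6 : ∑ c, a c = r := by
    rw [← sum_residue, ← (ofPair n p p).sum_rows]
    refine Finset.sum_congr rfl fun x _ => ?_
    change _ = ∑ᶠ y, pairEntry n p p x y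
    simp only [h5]
    rw [finsum_diag _ fun x => a (residue n x)]
  refine ⟨⟨a, Finset.mem_piAntidiag.2 ⟨h6, fun _ _ => Finset.mem_univ _⟩⟩, ?_⟩
  ext x y
  exact h5 x y

theorem act_one : act (1 : AffineSchur n r) = 1 := by
  classical
  refine Finsupp.lhom_ext' fun q => LinearMap.ext_ring ?_
  ext p
  change act (∑ l : Composition n r, e (diag l)) (Finsupp.single q 1) p = Finsupp.single q 1 p
  simp only [map_sum, LinearMap.sum_apply, Finsupp.finsetSum_apply, act_e, op_apply]
  by_cases h : p = q
  · subst h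
    obtain ⟨l, hl⟩ := exists_diag (n := n) p
    simp only [hl, diag_injective.eq_iff]
    simp
  · rw [Finsupp.single_apply, if_neg fun h' => h h'.symm]
    refine Finset.sum_eq_zero fun l _ => if_neg fun hl => h ?_
    funext t
    by_contra ht
    refine pairEntry_self_ne_zero n p q t ?_
    exact (congrFun (congrFun (congrArg Theta.entry hl) (p t)) (q t)).trans (if_neg ht)

instance : Ring (AffineSchur n r) :=
  { (inferInstance : AddCommGroup (AffineSchur n r)),
    (inferInstance : Mul (AffineSchur n r)),
    (inferInstance : One (AffineSchur n r)) with
    left_distrib := fun f g h => (mulLin f).map_add g h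
    right_distrib := fun f g h => LinearMap.map_add₂ mulLin f g h
    zero_mul := fun f => LinearMap.map_zero₂ mulLin f
    mul_zero := fun f => (mulLin f).map_zero
    mul_assoc := fun f g h => act_injective (by simp only [act_mul, mul_assoc])
    one_mul := fun f => act_injective (by rw [act_mul, act_one, one_mul])
    mul_one := fun f => act_injective (by rw [act_mul, act_one, mul_one]) }

instance : Algebra ℚ (AffineSchur n r) :=
  Algebra.ofModule (fun c f g => LinearMap.map_smul₂ mulLin c f g)
    (fun c f g => (mulLin f).map_smul c g)

/-- The linear map with `e_A ↦ e_B`, where `B` is the transpose of `A`. -/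
def transposeMap (n r : ℕ) [NeZero n] : AffineSchur n r →ₗ[ℚ] AffineSchur n r :=
  (basis n r).constr ℚ fun A => e (transpose A)

/-- The composition `λ = (2, 0)` in `Λ(2, 2)`. -/
def twoZero : Composition 2 2 := ⟨![2, 0], by simp [Finset.mem_piAntidiag]⟩

end Ring

end AffineSchur

end

/-! Let L be the ring of Laurent polynomials in t₁, t₂ over ℚ. The algebra S acts faithfully on the
free vector space on I(ℤ, 2), and it commutes with translations by 2ℤ². Splitting integers into
remainder and quotient modulo 2 turns this space into L⁴, with coordinates indexed by pairs of
residues. Commuting with the remaining place permutation means invariance under swapping residues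
and variables simultaneously, and S becomes the algebra of all 4 × 4 matrices over L with this
invariance (`laurentMatrix_injective`, `IsFlipInvariant.exists_laurentMatrix_eq`). In this model τ
is the transpose combined with tᵢ ↦ tᵢ⁻¹, and e = e_λ is the matrix unit at the residue pair (1, 1).

The corner e S e is then the ring of symmetric Laurent polynomials, that is ℚ[t₁ + t₂, (t₁t₂)^±¹].
An element of S e is a flip-invariant column: symmetric entries at (1, 1) and (0, 0), an arbitrary
entry at (1, 0), and its mirror image at (0, 1). Since L is free over the symmetric elements with
basis 1, t₁, the module S e is free of rank four. The four basis columns stay independent over all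
of L, because t₁ - t₂ is not a zero divisor. Hence S e ⊗ e S → S e S is injective, which is what
`isAffineCellIdealWith_of_basis` needs.

For the quotient, put t₁ = t₂ = T. A flip-invariant matrix then commutes with the swap of residue
pairs, so the antisymmetric vector spans a stable line, which gives a character S → ℚ[T, T⁻¹]. It
kills e. Conversely, if it kills a matrix, the obstruction to writing that matrix by products of
invariant columns and rows is divisible by t₁ - t₂ and can be removed
(`mem_idealGeneratedBy_eTwoZero`). Diagonal matrices provide a section compatible with τ
(`exists_section`), whose range is the stable complement required in a cell chain. -/

noncomputable section

/-! ### Affine cell ideals generated by an idempotent -/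

section CellIdeals

universe u v
variable {k : Type u} {A : Type v} [CommRing k] [Ring A] [Algebra k A]

theorem IsInvolution.map_one {τ : A →ₗ[k] A} (hτ : IsInvolution τ) : τ 1 = 1 := by
  have h := hτ.map_mul (τ 1) 1
  rw [mul_one, hτ.apply_apply, mul_one] at h
  exact h.symm

/-- An involution that preserves the range of an embedding restricts to the source. -/
theorem IsInvolution.exists_restrict {τ : A →ₗ[k] A} (hτ : IsInvolution τ) {B : Type*}
    [CommRing B] [Algebra k B] (ι : B →ₙₐ[k] A) (hι : Function.Injective ι)
    (hr : ∀ b, τ (ι b) ∈ Set.range ι) :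
    -- The embedding is only assumed multiplicative, not unital, so that its range may be a corner e
    -- A e, whose unit is e.
    ∃ σ : B →ₗ[k] B, IsInvolution σ ∧ ∀ b, ι (σ b) = τ (ι b) := by
  choose s hs using hr
  refine ⟨⟨⟨s, fun a b => hι ?_⟩, fun c a => hι ?_⟩, ⟨fun a b => hι ?_, fun a => hι ?_⟩, hs⟩
  · simp [hs]
  · simp [hs]
  · simp [hs, hτ.map_mul]
  · simp [hs, hτ.apply_apply]

theorem mul_mul_mem_idealGeneratedBy (e a b : A) : a * e * b ∈ idealGeneratedBy e :=
  Ideal.subset_span ⟨a, b, rfl⟩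

theorem mem_idealGeneratedBy_self (e : A) : e ∈ idealGeneratedBy e := by
  simpa using mul_mul_mem_idealGeneratedBy e 1 1

theorem idealGeneratedBy_le {e : A} {I : Ideal A} [I.IsTwoSided] (h : e ∈ I) :
    idealGeneratedBy e ≤ I := by
  refine Ideal.span_le.2 ?_
  rintro _ ⟨a, b, rfl⟩
  exact I.mul_mem_right _ (I.mul_mem_left _ h)

theorem IsInvolution.map_mem_idealGeneratedBy {τ : A →ₗ[k] A} (hτ : IsInvolution τ) {e : A}
    (he : τ e = e) {x : A} (hx : x ∈ idealGeneratedBy e) : τ x ∈ idealGeneratedBy e := by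
  refine Submodule.span_induction (p := fun x _ => τ x ∈ idealGeneratedBy e) ?_ ?_ ?_ ?_ hx
  · rintro _ ⟨a, b, rfl⟩
    rw [hτ.map_mul, hτ.map_mul, he, ← mul_assoc]
    exact mul_mul_mem_idealGeneratedBy _ _ _
  · simp
  · intro x y _ _ h1 h2
    rw [map_add]
    exact add_mem h1 h2
  · intro a x _ h
    rw [smul_eq_mul, hτ.map_mul]
    exact Ideal.mul_mem_right _ _ h

theorem IsInvolution.map_eq_of_map_mem {τ : A →ₗ[k] A} (hτ : IsInvolution τ)
    {M : Submodule k A} (h : ∀ x ∈ M, τ x ∈ M) : M.map τ = M :=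
  le_antisymm (Submodule.map_le_iff_le_comap.2 h)
    fun x hx => ⟨τ x, h x hx, hτ.apply_apply x⟩

/-- The basis of `B ⊗ kⁿ` over `B`. -/
abbrev tensorPiBasis (k B : Type*) [CommRing k] [CommRing B] [Algebra k B] (n : ℕ) :
    Module.Basis (Fin n) B (B ⊗[k] (Fin n → k)) :=
  Algebra.TensorProduct.basis B (Pi.basisFun k (Fin n))

/-- The basis vectors 1 ⊗ vⱼ are fixed by the switch, so only the coordinates are twisted. This
makes the switch computable in the coordinates used for Δ ⊗ Δ'. -/
theorem repr_switchMap {B : Type u} [CommRing B] [Algebra k B] (σ : B →ₗ[k] B) {n : ℕ}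
    (y : B ⊗[k] (Fin n → k)) (j : Fin n) :
    (tensorPiBasis k B n).repr (switchMap σ y) j = σ ((tensorPiBasis k B n).repr y j) := by
  induction y with
  | zero => simp
  | add x y hx hy => simp [hx, hy]
  | tmul b w =>
    simp only [switchMap, TensorProduct.map_tmul, LinearMap.id_apply,
      Algebra.TensorProduct.basis_repr_tmul, Finsupp.smul_apply, Finsupp.mapRange_apply,
      Pi.basisFun_repr, smul_eq_mul]
    rw [mul_comm, ← Algebra.smul_def, mul_comm, ← Algebra.smul_def, map_smul]

theorem switchMap_switchMap {B V : Type u} [CommRing B] [Algebra k B] [AddCommGroup V]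
    [Module k V] {σ : B →ₗ[k] B} (hσ : IsInvolution σ) (y : B ⊗[k] V) :
    switchMap σ (switchMap σ y) = y := by
  induction y with
  | zero => simp
  | add x y hx hy => simp [hx, hy]
  | tmul b w => simp [switchMap, hσ.apply_apply]

/-- Criterion for `A e A` to be an affine cell ideal: `A e` is free over `B ≅ e A e`, with a finite
basis `v`, and the products `vᵢ b τ(vⱼ)` satisfy no relations. -/
theorem isAffineCellIdealWith_of_basis {τ : A →ₗ[k] A} (hτ : IsInvolution τ) {e : A}
    (hτe : τ e = e) {B : Type u} [CommRing B] [Algebra k B] [Algebra.FiniteType k B]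
    {σ : B →ₗ[k] B} {ι : B →ₙₐ[k] A} (hσ : IsInvolution σ) (hισ : ∀ b, ι (σ b) = τ (ι b))
    (hι1 : ι 1 = e) {n : ℕ} (v : Fin n → A) (hv : ∀ i, v i * e = v i)
    (hgen : ∀ x, ∃ b : Fin n → B, x * e = ∑ i, v i * ι (b i))
    (hindep : ∀ b : Fin n → Fin n → B, ∑ i, ∑ j, v i * ι (b i j) * τ (v j) = 0 → b = 0) :
    IsAffineCellIdealWith τ (idealGeneratedBy e) (Fin n → k) B σ := by
  classical
  let bB := tensorPiBasis k B n
  have bB_smul : ∀ (c : k) x i, bB.repr (c • x) i = c • bB.repr x i := fun c x i => by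
    rw [← algebraMap_smul B c x, map_smul, Finsupp.smul_apply, algebraMap_smul]
  -- This identifies Δ with A e, coordinates becoming coefficients of the `v i`.
  let u : B ⊗[k] (Fin n → k) →ₗ[k] A :=
    { toFun := fun x => ∑ i, v i * ι (bB.repr x i)
      map_add' := fun x y => by simp [mul_add, Finset.sum_add_distrib]
      map_smul' := fun c x => by
        simp only [bB_smul, map_smul, mul_smul_comm, Finset.smul_sum, RingHom.id_apply] }
  have u_apply : ∀ x, u x = ∑ i, v i * ι (bB.repr x i) := fun _ => rfl
  have u_smul : ∀ (b : B) x, u (b • x) = u x * ι b := by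
    intro b x
    simp [u_apply, Finset.sum_mul, mul_assoc, mul_comm b]
  have u_e : ∀ x, u x * e = u x := by
    intro x
    rw [← hι1, ← u_smul, one_smul]
  have u_inj : Function.Injective u := by
    refine (injective_iff_map_eq_zero u).2 fun x hx => bB.ext_elem fun i => ?_
    -- Multiplying a relation among the `v i'` by `τ (v i)` on the right gives a relation whose
    -- coefficient matrix is concentrated in column `i`.
    have := hindep (fun i' j => if j = i then bB.repr x i' else 0) (by
      have h : (∑ i', v i' * ι (bB.repr x i')) * τ (v i) = 0 := by
        rw [← u_apply, hx, zero_mul]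
      rw [← h, Finset.sum_mul]
      refine Finset.sum_congr rfl fun i' _ => ?_
      rw [Finset.sum_eq_single i]
      · simp
      · intro j _ hj
        simp [hj]
      · simp)
    simpa using congrFun (congrFun this i) i
  have u_surj : ∀ x, ∃ y, u y = x * e := by
    intro x
    obtain ⟨b, hb⟩ := hgen x
    refine ⟨bB.equivFun.symm b, ?_⟩
    rw [hb, u_apply]
    simp only [← Module.Basis.equivFun_apply, LinearEquiv.apply_symm_apply]
  let b2 := bB.tensorProduct bB
  have b2_smul : ∀ (c : k) x i, b2.repr (c • x) i = c • b2.repr x i := fun c x i => by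
    rw [← algebraMap_smul B c x, map_smul, Finsupp.smul_apply, algebraMap_smul]
  -- This is multiplication A e ⊗ e A → A e A, with e A written as τ(A e). On pure tensors it is
  -- u(x) τ(u(p y)), where the switch p undoes the twist by σ that τ introduces.
  let ψ : (B ⊗[k] (Fin n → k)) ⊗[B] (B ⊗[k] (Fin n → k)) →ₗ[k] A :=
    { toFun := fun z => ∑ p, v p.1 * ι (b2.repr z p) * τ (v p.2)
      map_add' := fun x y => by simp [mul_add, add_mul, Finset.sum_add_distrib]
      map_smul' := fun c x => by
        simp only [b2_smul, map_smul, mul_smul_comm, Finset.smul_sum, RingHom.id_apply,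
          smul_mul_assoc] }
  have ψ_apply : ∀ z, ψ z = ∑ p, v p.1 * ι (b2.repr z p) * τ (v p.2) := fun _ => rfl
  have ψ_tmul : ∀ x y, ψ (x ⊗ₜ y) = u x * τ (u (switchMap σ y)) := by
    intro x y
    rw [ψ_apply, Fintype.sum_prod_type, u_apply, u_apply, map_sum, Finset.sum_mul_sum]
    refine Finset.sum_congr rfl fun i _ => Finset.sum_congr rfl fun j _ => ?_
    rw [hτ.map_mul, repr_switchMap, ← hισ, hσ.apply_apply]
    simp only [b2, Module.Basis.tensorProduct_repr_tmul_apply, smul_eq_mul]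
    rw [mul_comm, map_mul]
    simp only [mul_assoc, bB]
  have ψ_inj : Function.Injective ψ := by
    refine fun z w hz => b2.ext_elem fun p => ?_
    rw [ψ_apply, ψ_apply, ← sub_eq_zero, ← Finset.sum_sub_distrib, Fintype.sum_prod_type] at hz
    have := hindep (fun i j => b2.repr z (i, j) - b2.repr w (i, j)) (by
      simpa only [map_sub, mul_sub, sub_mul] using hz)
    exact sub_eq_zero.1 (congrFun (congrFun this p.1) p.2)
  -- The action on Δ is left multiplication on A e pulled back along `u`. Its linearity and
  -- multiplicativity follow from the injectivity of `u`, whatever preimages are chosen.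
  choose g hg using u_surj
  have hg' : ∀ a x, u (g (a * u x)) = a * u x := by
    intro a x
    rw [hg, mul_assoc, u_e]
  let ρ₀ : A →ₗ[k] Module.End B (B ⊗[k] (Fin n → k)) :=
    { toFun := fun a =>
        { toFun := fun x => g (a * u x)
          map_add' := fun x y => u_inj (by
            rw [hg', map_add, map_add, hg', hg', mul_add])
          map_smul' := fun b x => u_inj (by
            rw [hg', RingHom.id_apply, u_smul, u_smul, hg', mul_assoc]) }
      map_add' := fun a b => LinearMap.ext fun x => u_inj (by
        change u (g ((a + b) * u x)) = u (g (a * u x) + g (b * u x))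
        rw [hg', map_add, hg', hg', add_mul])
      map_smul' := fun c a => LinearMap.ext fun x => u_inj (by
        change u (g ((c • a) * u x)) = u (c • g (a * u x))
        rw [hg', map_smul, hg', smul_mul_assoc]) }
  have hρ₀ : ∀ a x, u (ρ₀ a x) = a * u x := hg'
  let ρ : A →ₐ[k] Module.End B (B ⊗[k] (Fin n → k)) := AlgHom.ofLinearMap ρ₀
    (LinearMap.ext fun x => u_inj (by rw [hρ₀, one_mul, Module.End.one_apply]))
    (fun a b => LinearMap.ext fun x => u_inj (by
      rw [hρ₀, Module.End.mul_apply, hρ₀, hρ₀, mul_assoc]))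
  have hρ : ∀ a x, u (ρ a x) = a * u x := hρ₀
  have ψ_left : ∀ a z, a * ψ z ∈ LinearMap.range ψ := by
    intro a z
    induction z with
    | zero => simp
    | add x y hx hy =>
      rw [map_add, mul_add]
      exact add_mem hx hy
    | tmul x y => exact ⟨ρ a x ⊗ₜ y, by rw [ψ_tmul, ψ_tmul, hρ, mul_assoc]⟩
  have ψ_mem : ∀ z, ψ z ∈ (idealGeneratedBy e).restrictScalars k := by
    intro z
    rw [ψ_apply]
    refine sum_mem fun p _ => ?_
    rw [← hv p.1, mul_assoc]
    exact mul_mul_mem_idealGeneratedBy _ _ _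
  have ψ_surj : ∀ x ∈ idealGeneratedBy e, x ∈ LinearMap.range ψ := by
    intro x hx
    refine Submodule.span_induction (p := fun x _ => x ∈ LinearMap.range ψ) ?_ ?_ ?_ ?_ hx
    · rintro _ ⟨a, b, rfl⟩
      -- The two tensor factors represent e and τ(b) e; applying τ to the latter gives e b, so `ψ`
      -- takes the value e b here.
      have : a * e * b = (a * 1) * ψ (g e ⊗ₜ switchMap σ (g (τ b))) := by
        have hee : e * e = e := by
          have := u_e (g e)
          rw [hg] at this
          rw [← hι1, ← map_mul, one_mul]
        rw [ψ_tmul, switchMap_switchMap hσ, hg, hg, hτ.map_mul, hτ.apply_apply, hτe, hee, mul_one,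
          ← mul_assoc e e, hee, mul_assoc]
      rw [this]
      exact ψ_left _ _
    · exact zero_mem _
    · exact fun _ _ _ _ => add_mem
    · rintro a _ _ ⟨z, rfl⟩
      exact ψ_left a z
  -- This map goes from the tensor product to the ideal, so the isomorphism asked for is its
  -- inverse.
  let α := LinearEquiv.ofBijective (ψ.codRestrict _ ψ_mem)
    ⟨fun x y h => ψ_inj (congrArg Subtype.val h), fun x => by
      obtain ⟨z, hz⟩ := ψ_surj x.1 x.2
      exact ⟨z, Subtype.ext hz⟩⟩
  have hα : ∀ z, (α z : A) = ψ z := fun _ => rfl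
  refine ⟨hτ, inferInstance, hτ.map_eq_of_map_mem fun x hx => ?_, inferInstance,
    inferInstance, inferInstance, hσ, ρ, α.symm, ?_, ?_, ?_⟩
  · exact hτ.map_mem_idealGeneratedBy hτe hx
  · intro a x y
    rw [LinearEquiv.symm_symm, hα, hα, ψ_tmul, ψ_tmul, hρ, mul_assoc]
  · intro a x y
    rw [LinearEquiv.symm_symm, hα, hα, ψ_tmul, ψ_tmul, switchMap_switchMap hσ, hρ, hτ.map_mul,
      hτ.apply_apply, mul_assoc]
  · intro b₁ b₂ v₁ v₂
    rw [LinearEquiv.symm_symm, hα, hα, ψ_tmul, ψ_tmul, hτ.map_mul, hτ.apply_apply]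
    simp only [switchMap, TensorProduct.map_tmul, LinearMap.id_apply, hσ.apply_apply]

/-- Affine cell ideals are transported along isomorphisms of algebras with involution. -/
theorem IsAffineCellIdealWith.map_equiv {A' : Type*} [Ring A'] [Algebra k A'] {τ : A →ₗ[k] A}
    {τ' : A' →ₗ[k] A'} (φ : A ≃ₐ[k] A') (hφ : ∀ a, τ' (φ a) = φ (τ a)) {J : Ideal A}
    {J' : Ideal A'} (hJ : ∀ a, φ a ∈ J' ↔ a ∈ J) {V B : Type u} [AddCommGroup V] [Module k V]
    [CommRing B] [Algebra k B] {σ : B →ₗ[k] B} (h : IsAffineCellIdealWith τ J V B σ) :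
    IsAffineCellIdealWith τ' J' V B σ := by
  have hJ' : ∀ a, φ.symm a ∈ J ↔ a ∈ J' := fun a => by rw [← hJ, AlgEquiv.apply_symm_apply]
  have hφ' : ∀ a, τ (φ.symm a) = φ.symm (τ' a) := fun a => by
    rw [AlgEquiv.eq_symm_apply, ← hφ, AlgEquiv.apply_symm_apply]
  have hτ' : IsInvolution τ' := by
    refine ⟨fun a b => φ.symm.injective ?_, fun a => φ.symm.injective ?_⟩
    · rw [← hφ', map_mul, h.isInvolution.map_mul, map_mul, hφ', hφ']
    · rw [← hφ', ← hφ', h.isInvolution.apply_apply]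
  obtain ⟨ρ, α, h1, h2, h3⟩ := h.exists_iso
  let β : J.restrictScalars k ≃ₗ[k] J'.restrictScalars k :=
    LinearEquiv.ofSubmodules φ.toLinearEquiv _ _ (by
      ext x
      constructor
      · rintro ⟨y, hy, rfl⟩
        exact (hJ y).2 hy
      · intro hx
        exact ⟨φ.symm x, (hJ' x).2 hx, φ.apply_symm_apply x⟩)
  have hβ : ∀ x, (β x : A') = φ x := fun _ => rfl
  refine ⟨hτ', ⟨fun {a} b ha => ?_⟩, hτ'.map_eq_of_map_mem fun x hx => ?_, h.free, h.finite,
    h.affine, h.isInvolution_base, ρ.comp φ.symm.toAlgHom, β.symm.trans α, ?_, ?_, ?_⟩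
  · have := h.isTwoSided
    rw [← hJ', map_mul]
    exact J.mul_mem_right _ ((hJ' a).2 ha)
  · change τ' x ∈ J'
    rw [← hJ', ← hφ']
    have h4 : τ (φ.symm x) ∈ (J.restrictScalars k).map τ := ⟨_, (hJ' x).2 hx, rfl⟩
    rwa [h.map_eq] at h4
  · intro a x y
    have := congrArg φ (h1 (φ.symm a) x y)
    rw [map_mul, φ.apply_symm_apply] at this
    exact this
  · intro a x y
    have := congrArg φ (h2 (φ.symm a) x y)
    rw [map_mul, φ.apply_symm_apply, hφ'] at this
    exact this
  · intro b₁ b₂ v₁ v₂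
    have := congrArg φ (h3 b₁ b₂ v₁ v₂)
    rw [← hφ] at this
    exact this

/-- An affine commutative algebra is an affine cell ideal of itself, for every involution. -/
theorem isAffineCellIdeal_top {τ : A →ₗ[k] A} (hτ : IsInvolution τ) {C : Type u} [CommRing C]
    [Algebra k C] [Algebra.FiniteType k C] (φ : C ≃ₐ[k] A) : IsAffineCellIdeal τ (⊤ : Ideal A) := by
  let ι : C →ₙₐ[k] A := (φ : C →ₐ[k] A)
  have hι : ∀ c, ι c = φ c := fun _ => rfl
  obtain ⟨σ, hσ, hισ⟩ := hτ.exists_restrict ι φ.injective fun b => φ.surjective _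
  have htop : idealGeneratedBy (1 : A) = ⊤ :=
    (Ideal.eq_top_iff_one _).2 (mem_idealGeneratedBy_self 1)
  rw [← htop]
  -- The criterion is used with idempotent 1 and the one-element basis 1.
  refine ⟨Fin 1 → k, C, inferInstance, inferInstance, inferInstance, inferInstance, σ,
    isAffineCellIdealWith_of_basis hτ hτ.map_one hσ hισ (map_one φ) (fun _ => 1)
      (fun _ => mul_one _) (fun x => ⟨fun _ => φ.symm x, ?_⟩) fun b hb => ?_⟩
  · simp [hι]
  · funext i j
    rw [Subsingleton.elim i 0, Subsingleton.elim j 0]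
    simpa [hι, hτ.map_one] using hb

end CellIdeals

/-! ### Induced involutions and short cell chains -/

section CellChains

universe u v
variable {k : Type u} {A : Type v} [CommRing k] [Ring A] [Algebra k A]

/-- An involution induces an involution on the quotient by a stable two-sided ideal. -/
theorem IsInvolution.exists_induced {τ : A →ₗ[k] A} (hτ : IsInvolution τ) (I : Ideal A)
    [I.IsTwoSided] (hI : ∀ x ∈ I, τ x ∈ I) :
    ∃ τ' : (A ⧸ I) →ₗ[k] (A ⧸ I), IsInducedOnQuotient τ I τ' ∧ IsInvolution τ' := by
  have hmk : Function.Surjective (Ideal.Quotient.mk I) := Ideal.Quotient.mk_surjective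
  obtain ⟨g, hg⟩ : ∃ g : A ⧸ I → A ⧸ I,
      ∀ a, g (Ideal.Quotient.mk I a) = Ideal.Quotient.mk I (τ a) := by
    refine ⟨fun x => Ideal.Quotient.mk I (τ (hmk x).choose), fun a => Ideal.Quotient.eq.2 ?_⟩
    rw [← map_sub]
    exact hI _ (Ideal.Quotient.eq.1 (hmk (Ideal.Quotient.mk I a)).choose_spec)
  have hsmul : ∀ (c : k) a, c • Ideal.Quotient.mk I a = Ideal.Quotient.mk I (c • a) :=
    fun _ _ => rfl
  refine ⟨⟨⟨g, fun x y => ?_⟩, fun c x => ?_⟩, hg, ⟨fun x y => ?_, fun x => ?_⟩⟩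
  · obtain ⟨a, rfl⟩ := hmk x
    obtain ⟨b, rfl⟩ := hmk y
    rw [← map_add, hg, hg, hg, ← map_add, map_add τ]
  · obtain ⟨a, rfl⟩ := hmk x
    change g _ = c • g _
    rw [hsmul, hg, hg, hsmul, map_smul]
  · obtain ⟨a, rfl⟩ := hmk x
    obtain ⟨b, rfl⟩ := hmk y
    change g _ = g _ * g _
    rw [← _root_.map_mul (Ideal.Quotient.mk I), hg, hg, hg, ← _root_.map_mul, hτ.map_mul]
  · obtain ⟨a, rfl⟩ := hmk x
    change g (g _) = _
    rw [hg, hg, hτ.apply_apply]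

/-- The quotient by the zero ideal. -/
def quotientBotEquiv (k : Type u) (A : Type v) [CommRing k] [Ring A] [Algebra k A] :
    A ≃ₐ[k] A ⧸ (⊥ : Ideal A) :=
  AlgEquiv.ofBijective (Ideal.Quotient.mkₐ k ⊥)
    ⟨(injective_iff_map_eq_zero _).2 fun _ ha => Ideal.Quotient.eq_zero_iff_mem.1 ha,
      Ideal.Quotient.mk_surjective⟩

theorem iSup_fin_two_eq_sup {α : Type*} [CompleteLattice α] (f : Fin 2 → α) :
    ⨆ l, f l = f 0 ⊔ f 1 :=
  le_antisymm (iSup_le (Fin.forall_fin_two.2 ⟨le_sup_left, le_sup_right⟩))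
    (sup_le (le_iSup f 0) (le_iSup f 1))

theorem IsInvolution.exists_induced_bot {τ : A →ₗ[k] A} (hτ : IsInvolution τ) :
    ∃ τ' : (A ⧸ (⊥ : Ideal A)) →ₗ[k] (A ⧸ (⊥ : Ideal A)),
      IsInducedOnQuotient τ ⊥ τ' ∧ IsInvolution τ' := by
  refine hτ.exists_induced ⊥ fun x hx => ?_
  rw [Ideal.mem_bot] at hx ⊢
  rw [hx, map_zero]

/-- A cell ideal is a cell ideal of the quotient by the zero ideal. -/
theorem IsAffineCellIdealWith.exists_layer_bot {τ : A →ₗ[k] A} {J : Ideal A} {V B : Type u}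
    [AddCommGroup V] [Module k V] [CommRing B] [Algebra k B] {σ : B →ₗ[k] B}
    (h : IsAffineCellIdealWith τ J V B σ) :
    ∃ τ' : (A ⧸ (⊥ : Ideal A)) →ₗ[k] (A ⧸ (⊥ : Ideal A)), IsInducedOnQuotient τ ⊥ τ' ∧
      IsAffineCellIdeal τ' (J.map (Ideal.Quotient.mk ⊥)) := by
  obtain ⟨τ', h1, -⟩ := h.isInvolution.exists_induced_bot
  refine ⟨τ', h1, V, B, inferInstance, inferInstance, inferInstance, inferInstance, σ,
    h.map_equiv (quotientBotEquiv k A) h1 fun a => ?_⟩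
  have hmk : Function.Surjective (Ideal.Quotient.mk (⊥ : Ideal A)) := Ideal.Quotient.mk_surjective
  refine ⟨fun ha => ?_, fun ha => Ideal.mem_map_of_mem _ ha⟩
  obtain ⟨b, hb, hba⟩ := (Ideal.mem_map_iff_of_surjective _ hmk).1 ha
  rwa [← (quotientBotEquiv k A).injective hba]

/-- An algebra isomorphic to an affine commutative algebra is affine cellular, for every
involution. -/
theorem isAffineCellular_of_equiv {τ : A →ₗ[k] A} (hτ : IsInvolution τ) {C : Type u} [CommRing C]
    [Algebra k C] [Algebra.FiniteType k C] (φ : C ≃ₐ[k] A) : IsAffineCellular τ := by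
  refine ⟨hτ, 1, ![⊥, ⊤], ?_⟩
  have htwo : ∀ i, (![⊥, ⊤] : Fin 2 → Ideal A) i |>.IsTwoSided := by
    intro i
    fin_cases i
    · exact inferInstanceAs (⊥ : Ideal A).IsTwoSided
    · exact inferInstanceAs (⊤ : Ideal A).IsTwoSided
  refine ⟨htwo, ⟨fun _ => ⊤, ?_, fun _ => hτ.map_eq_of_map_mem fun _ _ => trivial, fun i => ?_⟩,
    fun i => ?_⟩
  · rw [DirectSum.isInternal_submodule_iff_iSupIndep_and_iSup_eq_top]
    refine ⟨?_, by simp⟩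
    intro i
    rw [iSup_eq_bot.2 fun j => iSup_eq_bot.2 fun hj => absurd (Subsingleton.elim j i) hj]
    exact disjoint_bot_right
  · fin_cases i <;> simp
  · obtain rfl : i = 0 := Subsingleton.elim _ _
    obtain ⟨τ', h1, h2⟩ := hτ.exists_induced_bot
    refine ⟨τ', h1, ?_⟩
    change IsAffineCellIdeal τ' ((⊤ : Ideal A).map (Ideal.Quotient.mk ⊥))
    rw [Ideal.map_top]
    exact isAffineCellIdeal_top h2 (φ.trans (quotientBotEquiv k A))

/-- A cell ideal with an affine commutative quotient and a stable complement gives a cell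
chain. -/
theorem IsAffineCellIdealWith.isAffineCellChain {τ : A →ₗ[k] A} {J : Ideal A} {V B : Type u}
    [AddCommGroup V] [Module k V] [CommRing B] [Algebra k B] {σ : B →ₗ[k] B}
    (h : IsAffineCellIdealWith τ J V B σ) [J.IsTwoSided] {C : Type u} [CommRing C] [Algebra k C]
    [Algebra.FiniteType k C] (φ : C ≃ₐ[k] A ⧸ J) {N : Submodule k A}
    (hN : IsCompl (J.restrictScalars k) N) (hτN : N.map τ = N) :
    IsAffineCellChain τ (m := 2) ![⊥, J, ⊤] := by
  have htwo : ∀ i, (![⊥, J, ⊤] : Fin 3 → Ideal A) i |>.IsTwoSided := by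
    intro i
    fin_cases i
    · exact inferInstanceAs (⊥ : Ideal A).IsTwoSided
    · exact inferInstanceAs J.IsTwoSided
    · exact inferInstanceAs (⊤ : Ideal A).IsTwoSided
  -- The lower layer is `J` inside A/0; the upper one is all of A/J, a cell ideal because A/J is
  -- affine commutative.
  refine ⟨htwo, ⟨![J.restrictScalars k, N], ?_, ?_, fun i => ?_⟩, fun i => ?_⟩
  · refine (DirectSum.isInternal_submodule_iff_isCompl _ (i := (0 : Fin 2)) (j := 1) (by simp)
      ?_).2 hN
    ext i
    fin_cases i <;> simp
  · intro l
    fin_cases l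
    · exact h.map_eq
    · exact hτN
  · rw [iSup_fin_two_eq_sup]
    fin_cases i
    · simp
    · simp
    · simpa using hN.sup_eq_top.symm
  · fin_cases i
    · exact h.exists_layer_bot
    · have hJ : ∀ x ∈ J, τ x ∈ J := fun x hx => by
        have h4 : τ x ∈ (J.restrictScalars k).map τ := ⟨x, hx, rfl⟩
        rwa [h.map_eq] at h4
      obtain ⟨τ', h1, h2⟩ := h.isInvolution.exists_induced J hJ
      refine ⟨τ', h1, ?_⟩
      change IsAffineCellIdeal τ' ((⊤ : Ideal A).map (Ideal.Quotient.mk J))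
      rw [Ideal.map_top]
      exact isAffineCellIdeal_top h2 φ

end CellChains

namespace AffineSchur

/-! ### Laurent polynomials in two variables and their symmetries -/

/-- The ring of Laurent polynomials in two variables `t₁, t₂`. -/
abbrev LaurentTwo : Type := AddMonoidAlgebra ℚ (ℤ × ℤ)

/-- The automorphism of the Laurent polynomials which swaps the two variables. -/
def flip : LaurentTwo ≃ₐ[ℚ] LaurentTwo := AddMonoidAlgebra.domCongr ℚ ℚ AddEquiv.prodComm

/-- The automorphism of the Laurent polynomials which inverts the two variables. -/
def conj : LaurentTwo ≃ₐ[ℚ] LaurentTwo := AddMonoidAlgebra.domCongr ℚ ℚ (AddEquiv.neg (ℤ × ℤ))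

theorem coeff_flip (f : LaurentTwo) (s : ℤ × ℤ) : (flip f).coeff s = f.coeff s.swap := by
  simp [flip, AddMonoidAlgebra.coeff_domCongr]

theorem coeff_conj (f : LaurentTwo) (s : ℤ × ℤ) : (conj f).coeff s = f.coeff (-s) := by
  simp [conj, AddMonoidAlgebra.coeff_domCongr]

theorem flip_single (s : ℤ × ℤ) (c : ℚ) :
    flip (AddMonoidAlgebra.single s c) = AddMonoidAlgebra.single s.swap c := by
  simp [flip]

theorem conj_single (s : ℤ × ℤ) (c : ℚ) :
    conj (AddMonoidAlgebra.single s c) = AddMonoidAlgebra.single (-s) c := by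
  simp [conj]

theorem flip_flip (f : LaurentTwo) : flip (flip f) = f := by
  ext s
  simp [coeff_flip]

theorem conj_conj (f : LaurentTwo) : conj (conj f) = f := by
  ext s
  simp [coeff_conj]

/-! ### Orbits of pairs of integer tuples, in residues and quotients -/

/-- The pairs of residues modulo `2`. -/
abbrev ResiduePair : Type := Fin 2 × Fin 2

/-- The pair of integers with the residues `a` and the quotients `s` modulo `2`. -/
def lift (s : ℤ × ℤ) (a : ResiduePair) : Tuple 2 :=
  ![((a.1 : ℕ) : ℤ) + 2 * s.1, ((a.2 : ℕ) : ℤ) + 2 * s.2]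

theorem lift_injective {s u : ℤ × ℤ} {a b : ResiduePair} (h : lift s a = lift u b) :
    s = u ∧ a = b := by
  obtain ⟨s1, s2⟩ := s
  obtain ⟨u1, u2⟩ := u
  obtain ⟨⟨a1, _⟩, ⟨a2, _⟩⟩ := a
  obtain ⟨⟨b1, _⟩, ⟨b2, _⟩⟩ := b
  have h0 := congrFun h 0
  have h1 := congrFun h 1
  simp only [lift, Matrix.cons_val_zero, Matrix.cons_val_one] at h0 h1
  simp only [Prod.mk.injEq, Fin.mk.injEq]
  omega

theorem lift_surjective (p : Tuple 2) : ∃ s a, lift s a = p := by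
  refine ⟨(p 0 / 2, p 1 / 2), (⟨(p 0 % 2).toNat, by omega⟩, ⟨(p 1 % 2).toNat, by omega⟩), ?_⟩
  funext t
  fin_cases t
  · simp only [lift, Fin.zero_eta, Matrix.cons_val_zero]
    omega
  · simp only [lift, Fin.mk_one, Matrix.cons_val_one, Matrix.cons_val_zero]
    omega

theorem lift_add (s u : ℤ × ℤ) (a : ResiduePair) (t : Fin 2) :
    lift (s + u) a t = lift s a t + ((2 : ℕ) : ℤ) * ![u.1, u.2] t := by
  fin_cases t <;> simp [lift] <;> ring

theorem ofPair_lift_add (s u v : ℤ × ℤ) (a b : ResiduePair) :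
    ofPair 2 (lift (s + v) a) (lift (u + v) b) = ofPair 2 (lift s a) (lift u b) :=
  (SameOrbit.ofPair_eq ⟨1, ![v.1, v.2], fun _ => ⟨lift_add _ _ _ _, lift_add _ _ _ _⟩⟩).symm

/-- A diagonal translation does not change the matrix, so the quotient of the second tuple can be
normalized to 0. Only the difference of the quotients matters, which becomes a Laurent exponent. -/
theorem ofPair_lift (s u : ℤ × ℤ) (a b : ResiduePair) :
    ofPair 2 (lift s a) (lift u b) = ofPair 2 (lift (s - u) a) (lift 0 b) := by
  rw [← ofPair_lift_add (s - u) 0 u, sub_add_cancel, zero_add]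

theorem lift_swap (s : ℤ × ℤ) (a : ResiduePair) (t : Fin 2) :
    lift s.swap a.swap t = lift s a (Equiv.swap 0 1 t) := by
  fin_cases t <;> simp [lift]

theorem ofPair_lift_swap (s u : ℤ × ℤ) (a b : ResiduePair) :
    ofPair 2 (lift s.swap a.swap) (lift u.swap b.swap) = ofPair 2 (lift s a) (lift u b) :=
  (SameOrbit.ofPair_eq ⟨Equiv.swap 0 1, 0, fun t => by simp [lift_swap]⟩).symm

/-- Keeping the second quotient equal to 0 forces the translation part of the Weyl group element to
vanish. Only the two place permutations remain. -/
theorem eq_or_eq_swap_of_ofPair_lift_eq {s s' : ℤ × ℤ} {a b a' b' : ResiduePair}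
    (h : ofPair 2 (lift s a) (lift 0 b) = ofPair 2 (lift s' a') (lift 0 b')) :
    (s' = s ∧ a' = a ∧ b' = b) ∨ (s' = s.swap ∧ a' = a.swap ∧ b' = b.swap) := by
  obtain ⟨w, ε, h⟩ := ofPair_eq_iff.1 h
  have hε : ∀ t, ε t = ![(ε 0, ε 1).1, (ε 0, ε 1).2] t := by
    intro t
    fin_cases t <;> rfl
  have hperm : ∀ w : Equiv.Perm (Fin 2), w = 1 ∨ w = Equiv.swap 0 1 := by decide
  rcases hperm w with rfl | rfl
  · have h1 : lift s' a' = lift (s + (ε 0, ε 1)) a := by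
      funext t
      rw [lift_add, ← hε, (h t).1]
      rfl
    have h2 : lift 0 b' = lift (0 + (ε 0, ε 1)) b := by
      funext t
      rw [lift_add, ← hε, (h t).2]
      rfl
    obtain ⟨h3, h4⟩ := lift_injective h1
    obtain ⟨h5, h6⟩ := lift_injective h2
    rw [zero_add] at h5
    rw [← h5, add_zero] at h3
    exact Or.inl ⟨h3, h4, h6⟩
  · have h1 : lift s' a' = lift (s.swap + (ε 0, ε 1)) a.swap := by
      funext t
      rw [lift_add, ← hε, (h t).1, lift_swap]
    have h2 : lift 0 b' = lift ((0 : ℤ × ℤ).swap + (ε 0, ε 1)) b.swap := by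
      funext t
      rw [lift_add, ← hε, (h t).2, lift_swap]
    obtain ⟨h3, h4⟩ := lift_injective h1
    obtain ⟨h5, h6⟩ := lift_injective h2
    rw [Prod.swap_zero, zero_add] at h5
    rw [← h5, add_zero] at h3
    exact Or.inr ⟨h3, h4, h6⟩

/-! ### The affine Schur algebra as an algebra of flip-invariant matrices -/

/-- The free vector space on `I(ℤ, 2)` as a free module of rank four over the Laurent
polynomials. -/
def toLaurentVector : (Tuple 2 →₀ ℚ) →ₗ[ℚ] (ResiduePair → LaurentTwo) where
  toFun w a := .ofCoeff (w.comapDomain (fun s => lift s a) fun _ _ _ _ h => (lift_injective h).1)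
  map_add' v w := by
    funext a
    ext s
    rfl
  map_smul' c w := by
    funext a
    ext s
    rfl

theorem coeff_toLaurentVector (w : Tuple 2 →₀ ℚ) (a : ResiduePair) (s : ℤ × ℤ) :
    (toLaurentVector w a).coeff s = w (lift s a) := rfl

theorem toLaurentVector_single (u : ℤ × ℤ) (b : ResiduePair) :
    toLaurentVector (Finsupp.single (lift u b) 1) =
      Pi.single b (AddMonoidAlgebra.single u (1 : ℚ)) := by
  classical
  funext a
  ext s
  rw [coeff_toLaurentVector, Finsupp.single_apply]
  by_cases hab : a = b
  · subst hab
    rw [Pi.single_eq_same, AddMonoidAlgebra.coeff_single, Finsupp.single_apply]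
    refine if_congr ⟨fun h => (lift_injective h).1, fun h => by rw [h]⟩ rfl rfl
  · rw [Pi.single_eq_of_ne hab, if_neg fun h => hab (lift_injective h).2.symm]
    rfl

/-- The matrix over the Laurent polynomials of the action of an element of the affine Schur
algebra. -/
def laurentMatrix : AffineSchur 2 2 →ₗ[ℚ] Matrix ResiduePair ResiduePair LaurentTwo where
  toFun f := Matrix.of fun a b => toLaurentVector (act f (Finsupp.single (lift 0 b) 1)) a
  map_add' f g := by
    ext a b : 2
    simp
  map_smul' c f := by
    ext a b : 2
    simp

theorem laurentMatrix_apply (f : AffineSchur 2 2) (a b : ResiduePair) :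
    laurentMatrix f a b = toLaurentVector (act f (Finsupp.single (lift 0 b) 1)) a := rfl

theorem coeff_laurentMatrix (f : AffineSchur 2 2) (a b : ResiduePair) (s : ℤ × ℤ) :
    (laurentMatrix f a b).coeff s = (basis 2 2).repr f (ofPair 2 (lift s a) (lift 0 b)) := by
  rw [laurentMatrix_apply, coeff_toLaurentVector, act_apply]

/-- The action commutes with translations by 2ℤ², hence is linear over the Laurent polynomials and
determined by the vectors with quotient 0, whose images are the columns of the matrix.
Multiplicativity of `laurentMatrix` follows. -/
theorem toLaurentVector_act (f : AffineSchur 2 2) (w : Tuple 2 →₀ ℚ) :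
    toLaurentVector (act f w) = (laurentMatrix f).mulVec (toLaurentVector w) := by
  have h : toLaurentVector ∘ₗ act f =
      ((laurentMatrix f).mulVecLin.restrictScalars ℚ) ∘ₗ toLaurentVector := by
    refine Finsupp.lhom_ext' fun q => LinearMap.ext_ring ?_
    obtain ⟨u, b, rfl⟩ := lift_surjective q
    simp only [LinearMap.comp_apply, Finsupp.lsingle_apply, LinearMap.restrictScalars_apply,
      Matrix.mulVecLin_apply, toLaurentVector_single, Matrix.mulVec_single]
    funext a
    ext s
    rw [coeff_toLaurentVector, act_apply, ofPair_lift, ← coeff_laurentMatrix]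
    simp [AddMonoidAlgebra.coeff_mul_single_apply, sub_eq_add_neg]
  exact LinearMap.congr_fun h w

theorem laurentMatrix_mul (f g : AffineSchur 2 2) :
    laurentMatrix (f * g) = laurentMatrix f * laurentMatrix g := by
  ext a c : 2
  rw [laurentMatrix_apply, act_mul, Module.End.mul_apply, toLaurentVector_act]
  rfl

theorem laurentMatrix_one : laurentMatrix (1 : AffineSchur 2 2) = 1 := by
  ext a b : 2
  rw [laurentMatrix_apply, act_one, Module.End.one_apply, toLaurentVector_single,
    Matrix.one_apply, Pi.single_apply]
  rfl

theorem laurentMatrix_injective : Function.Injective laurentMatrix := by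
  intro f g h
  refine (basis 2 2).ext_elem fun A => ?_
  obtain ⟨p, q, rfl⟩ := exists_ofPair A
  obtain ⟨s, a, rfl⟩ := lift_surjective p
  obtain ⟨u, b, rfl⟩ := lift_surjective q
  rw [ofPair_lift, ← coeff_laurentMatrix, ← coeff_laurentMatrix, h]

/-- The matrices which are invariant under the swap of the two tensor factors. -/
def IsFlipInvariant (X : Matrix ResiduePair ResiduePair LaurentTwo) : Prop :=
  ∀ a b, X a.swap b.swap = flip (X a b)

theorem isFlipInvariant_laurentMatrix (f : AffineSchur 2 2) :
    IsFlipInvariant (laurentMatrix f) := by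
  intro a b
  ext s
  rw [coeff_flip, coeff_laurentMatrix, coeff_laurentMatrix, ← ofPair_lift_swap s.swap 0]
  rfl

/-- The positions (s, a, b) that share a matrix in Θ differ at most by the swap, so flip invariance
says exactly that the coefficients of `X` descend to a function on Θ. This surjectivity allows
elements of S to be constructed by writing down matrices. -/
theorem IsFlipInvariant.exists_laurentMatrix_eq {X : Matrix ResiduePair ResiduePair LaurentTwo}
    (hX : IsFlipInvariant X) : ∃ f, laurentMatrix f = X := by
  classical
  have hdec : ∀ A : Theta 2 2, ∃ s a b, ofPair 2 (lift s a) (lift 0 b) = A := by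
    intro A
    obtain ⟨p, q, rfl⟩ := exists_ofPair A
    obtain ⟨s, a, rfl⟩ := lift_surjective p
    obtain ⟨u, b, rfl⟩ := lift_surjective q
    exact ⟨s - u, a, b, (ofPair_lift _ _ _ _).symm⟩
  choose S P Q hSPQ using hdec
  have key : ∀ s a b s' a' b', ofPair 2 (lift s a) (lift 0 b) = ofPair 2 (lift s' a') (lift 0 b') →
      (X a b).coeff s = (X a' b').coeff s' := by
    intro s a b s' a' b' h
    obtain ⟨rfl, rfl, rfl⟩ | ⟨rfl, rfl, rfl⟩ := eq_or_eq_swap_of_ofPair_lift_eq h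
    · rfl
    · rw [hX, coeff_flip, Prod.swap_swap]
  -- Each of the sixteen entries has finite support, and every such A comes from a point of one of
  -- these supports.
  have hfin : {A | (X (P A) (Q A)).coeff (S A) ≠ 0}.Finite := by
    refine (Set.finite_iUnion fun ab : ResiduePair × ResiduePair =>
      ((X ab.1 ab.2).coeff.support.finite_toSet.image
        fun s => ofPair 2 (lift s ab.1) (lift 0 ab.2))).subset ?_
    intro A hA
    refine Set.mem_iUnion.2 ⟨(P A, Q A), S A, ?_, hSPQ A⟩
    simpa using hA
  refine ⟨(basis 2 2).repr.symm (Finsupp.onFinset hfin.toFinset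
    (fun A => (X (P A) (Q A)).coeff (S A)) fun A hA => by simpa using hA), ?_⟩
  ext a b s
  rw [coeff_laurentMatrix, LinearEquiv.apply_symm_apply, Finsupp.onFinset_apply]
  exact key _ _ _ _ _ _ (hSPQ _)

theorem repr_transposeMap (f : AffineSchur 2 2) (p q : Tuple 2) :
    (basis 2 2).repr (transposeMap 2 2 f) (ofPair 2 p q) = (basis 2 2).repr f (ofPair 2 q p) := by
  classical
  have h : Finsupp.lapply (ofPair 2 p q) ∘ₗ (basis 2 2).repr.toLinearMap ∘ₗ transposeMap 2 2 =
      Finsupp.lapply (ofPair 2 q p) ∘ₗ (basis 2 2).repr.toLinearMap := by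
    refine (basis 2 2).ext fun A => ?_
    change (basis 2 2).repr (transposeMap 2 2 (basis 2 2 A)) _ = (basis 2 2).repr (basis 2 2 A) _
    rw [transposeMap, Module.Basis.constr_basis, e, Module.Basis.repr_self,
      Module.Basis.repr_self, Finsupp.single_apply, Finsupp.single_apply]
    refine if_congr ⟨fun h => ?_, fun h => ?_⟩ rfl rfl
    · rw [← transpose_ofPair p q, ← h]
      rfl
    · rw [h, transpose_ofPair]
  exact LinearMap.congr_fun h f

/-- Transposing exchanges the two tuples of a pair; normalizing the second quotient again negates
the exponent. -/
theorem laurentMatrix_transposeMap (f : AffineSchur 2 2) (a b : ResiduePair) :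
    laurentMatrix (transposeMap 2 2 f) a b = conj (laurentMatrix f b a) := by
  ext s
  rw [coeff_conj, coeff_laurentMatrix, coeff_laurentMatrix, repr_transposeMap, ofPair_lift,
    zero_sub]

theorem isInvolution_transposeMap : IsInvolution (transposeMap 2 2) := by
  refine ⟨fun f g => laurentMatrix_injective ?_, fun f => laurentMatrix_injective ?_⟩
  · ext a b : 2
    simp only [laurentMatrix_transposeMap, laurentMatrix_mul, Matrix.mul_apply, map_sum, map_mul,
      mul_comm]
  · ext a b : 2
    simp only [laurentMatrix_transposeMap, conj_conj]

theorem lift_zero_one_one (t : Fin 2) : lift 0 (1, 1) t = 1 := by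
  fin_cases t <;> simp [lift]

/-- Two conventions meet here: `residue 2` gives the class of the integer 1 the index 0, whereas
`lift` uses ordinary remainders. The first part of λ thus belongs to the odd integers, and (2, 0) to
the residue pair (1, 1). -/
theorem diag_twoZero : diag twoZero = ofPair 2 (lift 0 (1, 1)) (lift 0 (1, 1)) := by
  ext x y
  change (if x = y then (![2, 0] : Fin 2 → ℕ) (residue 2 x) else 0) =
    ∑ t, E 2 (lift 0 (1, 1) t) (lift 0 (1, 1) t) x y
  simp only [E_eq, lift_zero_one_one, Finset.sum_const, Finset.card_univ, Fintype.card_fin,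
    smul_eq_mul, Nat.cast_ofNat]
  rcases Int.emod_two_eq_zero_or_one x with hx | hx
  · have h1 : residue 2 x = 1 := by
      ext
      change ((x - 1) % ((2 : ℕ) : ℤ)).toNat = 1
      omega
    rw [h1, if_neg (show ¬(2 ∣ x - 1 ∧ y = 1 + (x - 1)) by omega)]
    simp
  · have h1 : residue 2 x = 0 := by
      ext
      change ((x - 1) % ((2 : ℕ) : ℤ)).toNat = 0
      omega
    rw [h1]
    by_cases hxy : x = y
    · rw [if_pos hxy, if_pos (by omega)]
      rfl
    · rw [if_neg hxy, if_neg (by omega)]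

theorem laurentMatrix_e_twoZero :
    laurentMatrix (e (diag twoZero)) = Matrix.single (1, 1) (1, 1) 1 := by
  classical
  ext a b s
  rw [coeff_laurentMatrix, e, Module.Basis.repr_self, diag_twoZero, Finsupp.single_apply]
  have h0 : ofPair 2 (lift 0 (1, 1)) (lift 0 (1, 1)) = ofPair 2 (lift s a) (lift 0 b) →
      s = 0 ∧ a = (1, 1) ∧ b = (1, 1) := by
    intro h
    obtain h | h := eq_or_eq_swap_of_ofPair_lift_eq h
    · exact h
    · exact h
  by_cases h : (1, 1) = a ∧ (1, 1) = b
  · obtain ⟨rfl, rfl⟩ := h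
    rw [Matrix.single_apply_same, AddMonoidAlgebra.one_def, AddMonoidAlgebra.coeff_single,
      Finsupp.single_apply]
    exact if_congr ⟨fun h => (h0 h).1.symm, fun h => by rw [h]⟩ rfl rfl
  · rw [if_neg fun h' => h ⟨(h0 h').2.1.symm, (h0 h').2.2.symm⟩, Matrix.single_apply, if_neg h]
    rfl

/-! ### Symmetric Laurent polynomials -/

/-- The monomial `t₁ ^ m * t₂ ^ n`. -/
def mono (m n : ℤ) : LaurentTwo := AddMonoidAlgebra.single (m, n) 1

theorem mono_mul (m n m' n' : ℤ) : mono m n * mono m' n' = mono (m + m') (n + n') := by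
  simp [mono, AddMonoidAlgebra.single_mul_single]

theorem mono_zero : mono 0 0 = 1 := rfl

theorem flip_mono (m n : ℤ) : flip (mono m n) = mono n m := flip_single _ _

theorem conj_mono (m n : ℤ) : conj (mono m n) = mono (-m) (-n) := conj_single _ _

theorem LaurentTwo.induction {p : LaurentTwo → Prop} (hm : ∀ m n, p (mono m n))
    (hadd : ∀ f g, p f → p g → p (f + g)) (hsmul : ∀ (c : ℚ) f, p f → p (c • f)) (f) : p f := by
  induction f using AddMonoidAlgebra.induction_on with
  | of s => exact hm _ _
  | add f g hf hg => exact hadd f g hf hg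
  | smul c f hf => exact hsmul c f hf

theorem laurent_induction {p : ℚ[T;T⁻¹] → Prop} (hm : ∀ n, p (LaurentPolynomial.T n))
    (hadd : ∀ f g, p f → p g → p (f + g)) (hsmul : ∀ (c : ℚ) f, p f → p (c • f)) (f) : p f := by
  induction f using AddMonoidAlgebra.induction_on with
  | of s => exact hm _
  | add f g hf hg => exact hadd f g hf hg
  | smul c f hf => exact hsmul c f hf

theorem mono_sub_ne_zero : mono 1 0 - mono 0 1 ≠ 0 := by
  intro h
  have := congrArg (fun f => f.coeff (1, 0)) h
  simp [mono] at this

/-- The Laurent polynomials in `t₁ t₂`. -/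
def diagHom : ℚ[T;T⁻¹] →ₐ[ℚ] LaurentTwo :=
  AddMonoidAlgebra.mapDomainAlgHom ℚ ℚ ((AddMonoidHom.id ℤ).prod (AddMonoidHom.id ℤ))

/-- The symmetric Laurent polynomials: `T` is mapped to `t₁ t₂` and `X` to `t₁ + t₂`. -/
def symm : ℚ[T;T⁻¹][X] →ₐ[ℚ] LaurentTwo :=
  Polynomial.eval₂AlgHom diagHom (mono 1 0 + mono 0 1) fun _ => Commute.all _ _

theorem symm_X : symm Polynomial.X = mono 1 0 + mono 0 1 :=
  Polynomial.eval₂_X _ _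

theorem symm_C (r : ℚ[T;T⁻¹]) : symm (Polynomial.C r) = diagHom r :=
  Polynomial.eval₂_C _ _

theorem symm_eq_sum (p : ℚ[T;T⁻¹][X]) : symm p =
    ∑ i ∈ Finset.range (p.natDegree + 1), diagHom (p.coeff i) * (mono 1 0 + mono 0 1) ^ i :=
  Polynomial.eval₂_eq_sum_range _ _

theorem diagHom_T (n : ℤ) : diagHom (LaurentPolynomial.T n) = mono n n :=
  AddMonoidAlgebra.mapDomain_single

theorem symm_C_T (n : ℤ) : symm (Polynomial.C (LaurentPolynomial.T n)) = mono n n := by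
  rw [symm_C, diagHom_T]

theorem coeff_mono_mul (m n : ℤ) (f : LaurentTwo) (s : ℤ × ℤ) :
    (mono m n * f).coeff s = f.coeff (s - (m, n)) := by
  simp [mono, AddMonoidAlgebra.coeff_single_mul_apply, sub_eq_neg_add]

theorem coeff_diagHom (r : ℚ[T;T⁻¹]) (m n : ℤ) :
    (diagHom r).coeff (m, n) = if m = n then r.coeff n else 0 := by
  induction r using laurent_induction with
  | hm k =>
    rw [diagHom_T, LaurentPolynomial.T_apply]
    simp only [mono, AddMonoidAlgebra.coeff_single, Finsupp.single_apply, Prod.mk.injEq]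
    split_ifs <;> first | rfl | omega
  | hadd f g hf hg => simp [hf, hg]; split_ifs <;> simp
  | hsmul c f hf => simp [hf]

/-- In a monomial of r(t₁t₂)(t₁ + t₂)^i the exponent of t₁ exceeds that of t₂ by at most i, with
equality only through the term t₁^i. The coefficients at excess m ≥ i therefore isolate r. -/
theorem coeff_diagHom_mul_pow (r : ℚ[T;T⁻¹]) (i : ℕ) (m k : ℤ) (him : i ≤ m) :
    (diagHom r * (mono 1 0 + mono 0 1) ^ i).coeff (m + k, k) =
      if m = i then r.coeff k else 0 := by
  induction i generalizing m k with
  | zero =>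
    rw [pow_zero, mul_one, coeff_diagHom]
    exact if_congr (by simp) rfl rfl
  | succ i ih =>
    push_cast at him
    have h1 := ih (m - 1) k (by omega)
    have h2 := ih (m + 1) (k - 1) (by omega)
    rw [pow_succ', mul_left_comm, add_mul, AddMonoidAlgebra.coeff_add, Finsupp.add_apply,
      coeff_mono_mul, coeff_mono_mul]
    have h3 : ((m + k, k) : ℤ × ℤ) - (1, 0) = (m - 1 + k, k) := by
      rw [Prod.mk_sub_mk, sub_zero, add_sub_right_comm]
    have h4 : ((m + k, k) : ℤ × ℤ) - (0, 1) = (m + 1 + (k - 1), k - 1) := by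
      rw [Prod.mk_sub_mk, sub_zero, add_add_sub_cancel]
    rw [h3, h4, h1, h2]
    -- The summand coming from t₂ would need excess m + 1, which is larger than i.
    rw [if_neg (show ¬(m + 1 = (i : ℤ)) by omega), add_zero]
    push_cast
    exact if_congr (by omega) rfl rfl

/-- The coefficients whose exponent excess equals the degree recover the leading coefficient, since
lower powers of t₁ + t₂ do not reach that excess. -/
theorem symm_injective : Function.Injective symm := by
  refine (injective_iff_map_eq_zero symm).2 fun p hp => ?_
  rw [← Polynomial.leadingCoeff_eq_zero]
  ext k
  have h := congrArg (fun f => f.coeff ((p.natDegree : ℤ) + k, k)) hp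
  simp only [symm_eq_sum, AddMonoidAlgebra.coeff_sum, Finsupp.finsetSum_apply] at h
  rw [Finset.sum_eq_single p.natDegree] at h
  · rw [coeff_diagHom_mul_pow _ _ _ _ le_rfl, if_pos rfl] at h
    exact h
  · intro i hi hne
    rw [Finset.mem_range] at hi
    rw [coeff_diagHom_mul_pow _ _ _ _ (by omega), if_neg (by omega)]
  · simp

theorem flip_symm (b : ℚ[T;T⁻¹][X]) : flip (symm b) = symm b := by
  rw [symm_eq_sum, map_sum]
  refine Finset.sum_congr rfl fun i _ => ?_
  rw [map_mul, map_pow, map_add, flip_mono, flip_mono, add_comm (mono 0 1)]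
  congr 1
  ext ⟨m, n⟩
  rw [coeff_flip, Prod.swap_prod_mk, coeff_diagHom, coeff_diagHom]
  split_ifs with h1 h2 h2
  · rw [h1]
  · exact absurd h1.symm h2
  · exact absurd h2.symm h1
  · rfl

/-- The Laurent polynomials are generated by `1` and `t₁` over the symmetric ones. -/
theorem exists_symm_add_symm_mul (f : LaurentTwo) :
    ∃ a b, f = symm a + symm b * mono 1 0 := by
  have hx : (mono 1 0 + mono 0 1) * mono 1 0 = mono 1 0 * mono 1 0 + mono 1 1 := by
    rw [add_mul, mono_mul 0 1]
    rfl
  induction f using LaurentTwo.induction with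
  | hadd f g hf hg =>
    obtain ⟨a, b, rfl⟩ := hf
    obtain ⟨c, d, rfl⟩ := hg
    exact ⟨a + c, b + d, by simp only [map_add]; ring⟩
  | hsmul c f hf =>
    obtain ⟨a, b, rfl⟩ := hf
    exact ⟨c • a, c • b, by simp only [map_smul, smul_add, smul_mul_assoc]⟩
  | hm m n =>
    have h : ∀ m, ∃ a b, mono m 0 = symm a + symm b * mono 1 0 := by
      intro m
      induction m using Int.induction_on with
      | zero => exact ⟨1, 0, by simp [mono_zero]⟩
      | succ i ih =>
        obtain ⟨a, b, h⟩ := ih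
        -- This is the reduction t₁² = (t₁ + t₂) t₁ - t₁t₂.
        refine ⟨-b * Polynomial.C (LaurentPolynomial.T 1), a + b * Polynomial.X, ?_⟩
        rw [show mono (i + 1) 0 = mono i 0 * mono 1 0 by rw [mono_mul, add_zero], h]
        simp only [map_mul, map_add, map_neg, symm_X, symm_C_T]
        linear_combination (-symm b) * hx
      | pred i ih =>
        obtain ⟨a, b, h⟩ := ih
        have h2 : mono (-1) 0 * mono 1 0 = 1 := mono_mul _ _ _ _
        have h4 : mono (-1) (-1) * mono 0 1 = mono (-1) 0 := mono_mul _ _ _ _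
        -- This uses t₁⁻¹ = (t₁t₂)⁻¹ t₂ = (t₁t₂)⁻¹ ((t₁ + t₂) - t₁).
        refine ⟨b + a * Polynomial.C (LaurentPolynomial.T (-1)) * Polynomial.X,
          -a * Polynomial.C (LaurentPolynomial.T (-1)), ?_⟩
        rw [show mono (-i - 1) 0 = mono (-i) 0 * mono (-1) 0 by
          rw [mono_mul, add_zero, sub_eq_add_neg], h]
        simp only [map_mul, map_add, map_neg, symm_X, symm_C_T]
        linear_combination symm b * h2 - symm a * h4
    obtain ⟨a, b, h⟩ := h (m - n)
    refine ⟨a * Polynomial.C (LaurentPolynomial.T n), b * Polynomial.C (LaurentPolynomial.T n), ?_⟩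
    rw [show mono m n = mono (m - n) 0 * mono n n by rw [mono_mul, sub_add_cancel, zero_add], h]
    simp only [map_mul, symm_C_T]
    ring

/-- The Vandermonde determinant of the system is t₂ - t₁, nonzero in a domain. The unknowns need not
be symmetric, which matters in `column_independent`. -/
theorem eq_zero_of_add_mul_mono_eq_zero {a b : LaurentTwo} (h1 : a + mono 1 0 * b = 0)
    (h2 : a + mono 0 1 * b = 0) : a = 0 ∧ b = 0 := by
  have h3 : (mono 1 0 - mono 0 1) * b = 0 := by linear_combination h1 - h2
  have hb := (mul_eq_zero.1 h3).resolve_left mono_sub_ne_zero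
  rw [hb, mul_zero, add_zero] at h1
  exact ⟨h1, hb⟩

theorem exists_symm_eq {f : LaurentTwo} (hf : flip f = f) : ∃ b, symm b = f := by
  obtain ⟨a, b, rfl⟩ := exists_symm_add_symm_mul f
  rw [map_add, map_mul, flip_symm, flip_symm, flip_mono] at hf
  -- Symmetry of a + b t₁ says b (t₁ - t₂) = 0, which forces b = 0.
  have h := (eq_zero_of_add_mul_mono_eq_zero (a := 0) (b := symm b * (mono 1 0 - mono 0 1))
    (by linear_combination (-mono 1 0) * hf) (by linear_combination (-mono 0 1) * hf)).2
  have hb := (mul_eq_zero.1 h).resolve_right mono_sub_ne_zero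
  exact ⟨a, by rw [hb, zero_mul, add_zero]⟩

/-! ### Specialization to the diagonal t₁ = t₂ -/

/-- The specialization of both variables `t₁, t₂` to `T`. -/
def spec : LaurentTwo →ₐ[ℚ] ℚ[T;T⁻¹] :=
  AddMonoidAlgebra.mapDomainAlgHom ℚ ℚ ((AddMonoidHom.id ℤ).coprod (AddMonoidHom.id ℤ))

/-- The Laurent polynomials in `t₁`. -/
def inclLeft : ℚ[T;T⁻¹] →ₐ[ℚ] LaurentTwo :=
  AddMonoidAlgebra.mapDomainAlgHom ℚ ℚ (AddMonoidHom.inl ℤ ℤ)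

theorem spec_mono (m n : ℤ) : spec (mono m n) = LaurentPolynomial.T (m + n) :=
  AddMonoidAlgebra.mapDomain_single

theorem inclLeft_T (n : ℤ) : inclLeft (LaurentPolynomial.T n) = mono n 0 :=
  AddMonoidAlgebra.mapDomain_single

theorem spec_flip (f : LaurentTwo) : spec (flip f) = spec f := by
  induction f using LaurentTwo.induction with
  | hm m n => rw [flip_mono, spec_mono, spec_mono, add_comm]
  | hadd f g hf hg => simp only [map_add, hf, hg]
  | hsmul c f hf => simp only [map_smul, hf]

theorem spec_inclLeft (g : ℚ[T;T⁻¹]) : spec (inclLeft g) = g := by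
  induction g using laurent_induction with
  | hm n =>
    rw [inclLeft_T, spec_mono, add_zero]
  | hadd f g hf hg => simp only [map_add, hf, hg]
  | hsmul c f hf => simp only [map_smul, hf]

theorem conj_inclLeft (g : ℚ[T;T⁻¹]) :
    conj (inclLeft g) = inclLeft (LaurentPolynomial.invert g) := by
  induction g using laurent_induction with
  | hm n =>
    rw [inclLeft_T, conj_mono, LaurentPolynomial.invert_T, inclLeft_T, neg_zero]
  | hadd f g hf hg => simp only [map_add, hf, hg]
  | hsmul c f hf => simp only [map_smul, hf]

/-- Modulo t₁ - t₂ a factor t₂ or t₂⁻¹ may be traded for t₁ or t₁⁻¹, until no t₂ is left. So t₁ - t₂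
generates the kernel of `spec`. -/
theorem sub_dvd_sub_inclLeft_spec (f : LaurentTwo) :
    mono 1 0 - mono 0 1 ∣ f - inclLeft (spec f) := by
  induction f using LaurentTwo.induction with
  | hm m n =>
    rw [spec_mono, inclLeft_T]
    induction n using Int.induction_on generalizing m with
    | zero => simp
    | succ i ih =>
      have h : mono m (i + 1) - mono (m + (i + 1)) 0 =
          (mono (m + 1) i - mono (m + 1 + i) 0) - (mono 1 0 - mono 0 1) * mono m i := by
        rw [sub_mul, mono_mul, mono_mul, zero_add, zero_add, add_comm 1 m, add_comm 1 (i : ℤ),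
          show m + (i + 1 : ℤ) = m + 1 + i by ring]
        ring
      rw [h]
      exact dvd_sub (ih _) (dvd_mul_right _ _)
    | pred i ih =>
      have h : mono m (-i - 1) - mono (m + (-i - 1)) 0 =
          (mono (m - 1) (-i) - mono (m - 1 + -i) 0) +
            (mono 1 0 - mono 0 1) * mono (m - 1) (-i - 1) := by
        rw [sub_mul, mono_mul, mono_mul, zero_add, zero_add, add_sub_cancel, add_sub_cancel,
          show m + (-i - 1 : ℤ) = m - 1 + -i by ring]
        ring
      rw [h]
      exact dvd_add (ih _) (dvd_mul_right _ _)
  | hadd f g hf hg =>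
    simp only [map_add]
    rw [add_sub_add_comm]
    exact dvd_add hf hg
  | hsmul c f hf =>
    simp only [map_smul]
    rw [← smul_sub]
    exact hf.trans ⟨algebraMap ℚ _ c, by rw [mul_comm, Algebra.smul_def]⟩

theorem exists_eq_mul_of_spec_eq {f g : LaurentTwo} (h : spec f = spec g) :
    ∃ c, f - g = (mono 1 0 - mono 0 1) * c := by
  have h1 := sub_dvd_sub_inclLeft_spec (f - g)
  rwa [map_sub, h, sub_self, map_zero, sub_zero] at h1

theorem forall_residuePair {p : ResiduePair → Prop} :
    (∀ a, p a) ↔ p (0, 0) ∧ p (0, 1) ∧ p (1, 0) ∧ p (1, 1) := by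
  rw [Prod.forall, Fin.forall_fin_two, Fin.forall_fin_two, Fin.forall_fin_two, and_assoc]

theorem flip_conj (f : LaurentTwo) : flip (conj f) = conj (flip f) := by
  ext s
  simp only [coeff_flip, coeff_conj]
  rfl

/-! ### The corner e S e, the module S e and the cell ideal S e S -/

/-- The element `e_λ` for `λ = (2, 0)`. -/
abbrev eTwoZero : AffineSchur 2 2 := e (diag twoZero)

theorem transposeMap_eTwoZero : transposeMap 2 2 eTwoZero = eTwoZero := by
  refine laurentMatrix_injective ?_
  ext a b : 2
  rw [laurentMatrix_transposeMap, laurentMatrix_e_twoZero, Matrix.single_apply,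
    Matrix.single_apply, apply_ite conj, map_one, map_zero]
  simp only [and_comm]

theorem laurentMatrix_mul_eTwoZero (f : AffineSchur 2 2) (a b : ResiduePair) :
    laurentMatrix (f * eTwoZero) a b = if b = (1, 1) then laurentMatrix f a (1, 1) else 0 := by
  rw [laurentMatrix_mul, laurentMatrix_e_twoZero]
  split_ifs with h
  · rw [h, Matrix.mul_single_apply_same, mul_one]
  · rw [Matrix.mul_single_apply_of_ne _ _ _ _ _ h]

theorem laurentMatrix_eTwoZero_mul_mul (f : AffineSchur 2 2) :
    laurentMatrix (eTwoZero * f * eTwoZero) =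
      Matrix.single (1, 1) (1, 1) (laurentMatrix f (1, 1) (1, 1)) := by
  rw [laurentMatrix_mul, laurentMatrix_mul, laurentMatrix_e_twoZero, Matrix.single_mul_mul_single,
    one_mul, mul_one]

theorem isFlipInvariant_single {x : LaurentTwo} (hx : flip x = x) :
    IsFlipInvariant (Matrix.single (1, 1) (1, 1) x) := by
  rintro ⟨a, a'⟩ ⟨b, b'⟩
  rw [Matrix.single_apply, Matrix.single_apply, apply_ite flip, hx, map_zero]
  refine if_congr ?_ rfl rfl
  simp only [Prod.swap_prod_mk, Prod.mk.injEq]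
  tauto

/-- The polynomial ring `ℚ[T, T⁻¹][X]` is isomorphic to `e_λ S e_λ`. -/
theorem exists_corner_embedding : ∃ ι : ℚ[T;T⁻¹][X] →ₙₐ[ℚ] AffineSchur 2 2,
    ∀ b, laurentMatrix (ι b) = Matrix.single (1, 1) (1, 1) (symm b) := by
  -- The element with a given matrix is unique, so all algebraic identities can be checked on
  -- matrices.
  choose g hg using fun b => (isFlipInvariant_single (flip_symm b)).exists_laurentMatrix_eq
  refine ⟨{ toFun := g, map_smul' := ?_, map_zero' := ?_, map_add' := ?_, map_mul' := ?_ }, hg⟩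
  · intro c x
    refine laurentMatrix_injective ?_
    rw [map_smul, hg, MonoidHom.id_apply, hg, map_smul, Matrix.smul_single]
  · refine laurentMatrix_injective ?_
    rw [hg, map_zero, map_zero, Matrix.single_zero]
  · intro x y
    refine laurentMatrix_injective ?_
    rw [map_add, hg, hg, hg, map_add, Matrix.single_add]
  · intro x y
    refine laurentMatrix_injective ?_
    rw [laurentMatrix_mul, hg, hg, hg, map_mul, Matrix.single_mul_single_same]

/-- The flip-invariant vectors with the entries `x` at `(1, 1)`, `y` at `(1, 0)` and `z` at
`(0, 0)`. -/
def invariantVector (x y z : LaurentTwo) (a : ResiduePair) : LaurentTwo :=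
  ![![z, flip y], ![y, x]] a.1 a.2

theorem invariantVector_swap {x z : LaurentTwo} (hx : flip x = x) (hz : flip z = z)
    (y : LaurentTwo) (a : ResiduePair) :
    invariantVector x y z a.swap = flip (invariantVector x y z a) := by
  revert a
  rw [forall_residuePair]
  simp [invariantVector, hx, hz, flip_flip]

/-- A flip-invariant column is the column of an element of `S e_λ`. -/
theorem exists_column {c : ResiduePair → LaurentTwo} (hc : ∀ a, c a.swap = flip (c a)) :
    ∃ f : AffineSchur 2 2, f * eTwoZero = f ∧
      ∀ a b, laurentMatrix f a b = if b = (1, 1) then c a else 0 := by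
  have h : IsFlipInvariant (Matrix.of fun a b => if b = (1, 1) then c a else 0) := by
    rintro a ⟨b, b'⟩
    simp only [Matrix.of_apply]
    rw [apply_ite flip, map_zero, hc]
    refine if_congr ?_ rfl rfl
    simp only [Prod.swap_prod_mk, Prod.mk.injEq]
    tauto
  obtain ⟨f, hf⟩ := h.exists_laurentMatrix_eq
  have hf' : ∀ a b, laurentMatrix f a b = if b = (1, 1) then c a else 0 := fun a b => by
    rw [hf, Matrix.of_apply]
  refine ⟨f, laurentMatrix_injective ?_, hf'⟩
  ext a b : 2
  rw [laurentMatrix_mul_eTwoZero, hf', hf', if_pos rfl]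

/-- The coordinates of the basis of `S e_λ` over `e_λ S e_λ`. -/
def column : Fin 4 → ResiduePair → LaurentTwo :=
  ![invariantVector 1 0 0, invariantVector 0 1 0, invariantVector 0 (mono 1 0) 0,
    invariantVector 0 0 1]

theorem column_swap (i : Fin 4) (a : ResiduePair) : column i a.swap = flip (column i a) := by
  fin_cases i <;> exact invariantVector_swap (by simp) (by simp) _ _

theorem sum_column_mul (x : Fin 4 → LaurentTwo) (a : ResiduePair) :
    ∑ i, column i a * x i =
      ![![x 3, x 1 + mono 0 1 * x 2], ![x 1 + mono 1 0 * x 2, x 0]] a.1 a.2 := by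
  revert a
  rw [forall_residuePair]
  simp [Fin.sum_univ_four, column, invariantVector, flip_mono]

/-- The entries at (1, 1) and (0, 0) each see one coefficient, and those at (1, 0) and (0, 1) form a
Vandermonde system in t₁, t₂. Independence holds over all Laurent polynomials, not merely the
symmetric ones. -/
theorem column_independent {x : Fin 4 → LaurentTwo} (h : ∀ a, ∑ i, column i a * x i = 0) :
    x = 0 := by
  simp only [sum_column_mul] at h
  rw [forall_residuePair] at h
  simp only [Matrix.cons_val_zero, Matrix.cons_val_one] at h
  obtain ⟨h3, h12, h12', h0⟩ := h
  obtain ⟨h1, h2⟩ := eq_zero_of_add_mul_mono_eq_zero h12' h12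
  funext i
  fin_cases i
  · exact h0
  · exact h1
  · exact h2
  · exact h3

/-- Invariance makes the entries at (1, 1) and (0, 0) symmetric and determines the one at (0, 1)
from that at (1, 0), which is expanded in the basis 1, t₁. -/
theorem column_generates {c : ResiduePair → LaurentTwo} (hc : ∀ a, c a.swap = flip (c a)) :
    ∃ b : Fin 4 → ℚ[T;T⁻¹][X], ∀ a, c a = ∑ i, column i a * symm (b i) := by
  obtain ⟨b0, h0⟩ := exists_symm_eq (hc (1, 1)).symm
  obtain ⟨b3, h3⟩ := exists_symm_eq (hc (0, 0)).symm
  obtain ⟨b1, b2, h1⟩ := exists_symm_add_symm_mul (c (1, 0))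
  have h2 : c (0, 1) = symm b1 + symm b2 * mono 0 1 := by
    rw [show ((0, 1) : ResiduePair) = Prod.swap (1, 0) from rfl, hc, h1, map_add, map_mul,
      flip_symm, flip_symm, flip_mono]
  refine ⟨![b0, b1, b2, b3], ?_⟩
  simp only [sum_column_mul]
  rw [forall_residuePair]
  simp [h0, h1, h2, h3, mul_comm]

theorem laurentMatrix_column_mul {f g : AffineSchur 2 2} {c : ResiduePair → LaurentTwo}
    {x : LaurentTwo} (hf : ∀ a b, laurentMatrix f a b = if b = (1, 1) then c a else 0)
    (hg : laurentMatrix g = Matrix.single (1, 1) (1, 1) x) (a b : ResiduePair) :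
    laurentMatrix (f * g) a b = if b = (1, 1) then c a * x else 0 := by
  rw [laurentMatrix_mul, hg]
  split_ifs with h
  · rw [h, Matrix.mul_single_apply_same, hf, if_pos rfl]
  · rw [Matrix.mul_single_apply_of_ne _ _ _ _ _ h]

theorem laurentMatrix_column_mul_transposeMap {f g : AffineSchur 2 2}
    {c d : ResiduePair → LaurentTwo}
    (hf : ∀ a b, laurentMatrix f a b = if b = (1, 1) then c a else 0)
    (hg : ∀ a b, laurentMatrix g a b = if b = (1, 1) then d a else 0) (a b : ResiduePair) :
    laurentMatrix (f * transposeMap 2 2 g) a b = c a * conj (d b) := by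
  rw [laurentMatrix_mul, Matrix.mul_apply, Finset.sum_eq_single (1, 1)]
  · rw [laurentMatrix_transposeMap, hf, hg, if_pos rfl, if_pos rfl]
  · intro i _ hi
    rw [hf, if_neg hi, zero_mul]
  · simp

/-- The ideal `S e_λ S` is an affine cell ideal. -/
theorem exists_isAffineCellIdealWith :
    ∃ (σ : ℚ[T;T⁻¹][X] →ₗ[ℚ] ℚ[T;T⁻¹][X]) (ι : ℚ[T;T⁻¹][X] →ₙₐ[ℚ] AffineSchur 2 2),
      Function.Injective ι ∧ Set.range ι = {x | ∃ a, x = eTwoZero * a * eTwoZero} ∧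
      (∀ b, ι (σ b) = transposeMap 2 2 (ι b)) ∧
      IsAffineCellIdealWith (transposeMap 2 2) (idealGeneratedBy eTwoZero)
        (Fin 4 → ℚ) ℚ[T;T⁻¹][X] σ := by
  obtain ⟨ι, hι⟩ := exists_corner_embedding
  have hinj : Function.Injective ι := by
    intro x y h
    have h1 := congrArg (fun f => laurentMatrix f (1, 1) (1, 1)) h
    simp only [hι, Matrix.single_apply_same] at h1
    exact symm_injective h1
  have hι1 : ι 1 = eTwoZero := laurentMatrix_injective (by
    rw [hι, map_one, laurentMatrix_e_twoZero])
  have hrange : Set.range ι = {x | ∃ a, x = eTwoZero * a * eTwoZero} := by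
    refine Set.Subset.antisymm ?_ ?_
    · rintro _ ⟨b, rfl⟩
      refine ⟨ι b, ?_⟩
      rw [← hι1, ← map_mul, ← map_mul, one_mul, mul_one]
    · rintro _ ⟨a, rfl⟩
      obtain ⟨b, hb⟩ := exists_symm_eq (isFlipInvariant_laurentMatrix a (1, 1) (1, 1)).symm
      refine ⟨b, laurentMatrix_injective ?_⟩
      rw [hι, hb, laurentMatrix_eTwoZero_mul_mul]
  obtain ⟨σ, hσ, hισ⟩ := isInvolution_transposeMap.exists_restrict ι hinj fun b => by
    obtain ⟨a, ha⟩ := hrange.subset ⟨b, rfl⟩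
    rw [hrange, ha]
    refine ⟨transposeMap 2 2 a, ?_⟩
    rw [isInvolution_transposeMap.map_mul, isInvolution_transposeMap.map_mul,
      transposeMap_eTwoZero, mul_assoc]
  choose v hv hv' using fun i => exists_column (column_swap i)
  refine ⟨σ, ι, hinj, hrange, hισ, isAffineCellIdealWith_of_basis isInvolution_transposeMap
    transposeMap_eTwoZero hσ hισ hι1 v hv (fun x => ?_) fun b hb => ?_⟩
  · obtain ⟨b, hb⟩ := column_generates (c := fun a => laurentMatrix x a (1, 1))
      fun a => isFlipInvariant_laurentMatrix x a (1, 1)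
    refine ⟨b, laurentMatrix_injective ?_⟩
    ext a d : 2
    rw [laurentMatrix_mul_eTwoZero, map_sum, Matrix.sum_apply]
    simp only [laurentMatrix_column_mul (hv' _) (hι _), hb]
    split_ifs
    · rfl
    · simp
  -- The relation reads C b C* = 0 for the matrix C of basis columns. C is cancelled on the left,
  -- and after conjugation once more on the other side. The first cancellation involves coefficients
  -- that need not be symmetric.
  · have h1 : ∀ a c, ∑ i, column i a * ∑ j, symm (b i j) * conj (column j c) = 0 := by
      intro a c
      have h := congrArg (fun f => laurentMatrix f a c) hb
      simp only [map_sum, Matrix.sum_apply, map_zero, Matrix.zero_apply,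
        laurentMatrix_column_mul_transposeMap (laurentMatrix_column_mul (hv' _) (hι _)) (hv' _)]
        at h
      simpa only [Finset.mul_sum, mul_assoc] using h
    have h2 : ∀ i c, ∑ j, symm (b i j) * conj (column j c) = 0 := fun i c =>
      congrFun (column_independent fun a => h1 a c) i
    have h3 : ∀ i c, ∑ j, column j c * conj (symm (b i j)) = 0 := by
      intro i c
      have h := congrArg conj (h2 i c)
      simpa only [map_sum, map_mul, conj_conj, map_zero, mul_comm] using h
    funext i j
    have h4 := congrFun (column_independent fun c => h3 i c) j
    exact symm_injective (conj.injective (by simpa using h4))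

/-! ### The character on antisymmetric vectors and the quotient S / S e S -/

/-- The action of the affine Schur algebra on the antisymmetric vectors, after both variables have
been specialized to `T`. -/
def antisymmetricCharacter : AffineSchur 2 2 →ₐ[ℚ] ℚ[T;T⁻¹] :=
  AlgHom.ofLinearMap
    { toFun := fun f => spec (laurentMatrix f (1, 0) (1, 0)) - spec (laurentMatrix f (1, 0) (0, 1))
      map_add' := fun f g => by
        simp only [map_add, Matrix.add_apply]
        ring
      map_smul' := fun c f => by
        simp only [map_smul, Matrix.smul_apply, RingHom.id_apply, smul_sub] }
    (by simp [laurentMatrix_one])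
    (fun f g => by
      -- After specialization `g` commutes with the swap of residue pairs. So in the product the
      -- terms through (0, 0) and (1, 1) cancel, and the one through (0, 1) is minus its mirror
      -- image.
      have h0 : spec (laurentMatrix g (0, 0) (0, 1)) = spec (laurentMatrix g (0, 0) (1, 0)) := by
        rw [← spec_flip, ← isFlipInvariant_laurentMatrix]
        rfl
      have h1 : spec (laurentMatrix g (1, 1) (0, 1)) = spec (laurentMatrix g (1, 1) (1, 0)) := by
        rw [← spec_flip, ← isFlipInvariant_laurentMatrix]
        rfl
      have h2 : spec (laurentMatrix g (0, 1) (0, 1)) = spec (laurentMatrix g (1, 0) (1, 0)) := by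
        rw [← spec_flip, ← isFlipInvariant_laurentMatrix]
        rfl
      have h3 : spec (laurentMatrix g (0, 1) (1, 0)) = spec (laurentMatrix g (1, 0) (0, 1)) := by
        rw [← spec_flip, ← isFlipInvariant_laurentMatrix]
        rfl
      simp only [LinearMap.coe_mk, AddHom.coe_mk, laurentMatrix_mul, Matrix.mul_apply,
        Fintype.sum_prod_type, Fin.sum_univ_two, map_add, map_mul, h0, h1, h2, h3]
      ring)

theorem antisymmetricCharacter_apply (f : AffineSchur 2 2) : antisymmetricCharacter f =
    spec (laurentMatrix f (1, 0) (1, 0)) - spec (laurentMatrix f (1, 0) (0, 1)) := rfl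

theorem antisymmetricCharacter_eTwoZero : antisymmetricCharacter eTwoZero = 0 := by
  rw [antisymmetricCharacter_apply, laurentMatrix_e_twoZero]
  simp

/-- The product of a flip-invariant column with a flip-invariant row belongs to `S e_λ S`. -/
theorem exists_mem_idealGeneratedBy_eTwoZero {c d : ResiduePair → LaurentTwo}
    (hc : ∀ a, c a.swap = flip (c a)) (hd : ∀ a, d a.swap = flip (d a)) :
    ∃ f ∈ idealGeneratedBy eTwoZero, ∀ a b, laurentMatrix f a b = c a * d b := by
  obtain ⟨f, hfe, hf⟩ := exists_column hc
  -- The conjugate is taken in advance because the transpose conjugates the column back to the row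
  -- `d`.
  obtain ⟨g, -, hg⟩ := exists_column (c := fun a => conj (d a)) fun a => by rw [hd, flip_conj]
  refine ⟨f * transposeMap 2 2 g, ?_, fun a b => ?_⟩
  · rw [← hfe]
    exact mul_mul_mem_idealGeneratedBy _ _ _
  · rw [laurentMatrix_column_mul_transposeMap hf hg, conj_conj]

/-- All entries outside the middle block, indexed by (1, 0) and (0, 1), come from products of
invariant columns and rows. In that block a vanishing character means that the two entries of the
row (1, 0) differ by a multiple of t₁ - t₂, which is what such products can also supply. -/
theorem mem_idealGeneratedBy_eTwoZero {f : AffineSchur 2 2} :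
    f ∈ idealGeneratedBy eTwoZero ↔ antisymmetricCharacter f = 0 := by
  constructor
  · exact fun h => idealGeneratedBy_le (I := RingHom.ker antisymmetricCharacter)
      antisymmetricCharacter_eTwoZero h
  intro hf
  rw [antisymmetricCharacter_apply, sub_eq_zero] at hf
  obtain ⟨h, hh⟩ := exists_eq_mul_of_spec_eq hf
  have hX := isFlipInvariant_laurentMatrix f
  set X := laurentMatrix f with hXdef
  have hF : X (1, 0) (1, 0) = X (1, 0) (0, 1) + (mono 1 0 - mono 0 1) * h := by
    rw [← hh]
    ring
  have hinv : ∀ y, ∀ a, invariantVector 0 y 0 a.swap = flip (invariantVector 0 y 0 a) := fun y =>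
    invariantVector_swap (by simp) (by simp) y
  have hinv1 : ∀ a, invariantVector 1 0 0 a.swap = flip (invariantVector 1 0 0 a) :=
    invariantVector_swap (by simp) (by simp) 0
  have hinv2 : ∀ a, invariantVector 0 0 1 a.swap = flip (invariantVector 0 0 1 a) :=
    invariantVector_swap (by simp) (by simp) 0
  -- `g1` and `g2` are the full rows (1, 1) and (0, 0) of `X`; `g3` and `g4` are what remains of the
  -- columns (1, 1) and (0, 0).
  obtain ⟨g1, hg1, hg1'⟩ := exists_mem_idealGeneratedBy_eTwoZero (d := X (1, 1))
    hinv1 fun b => hX (1, 1) b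
  obtain ⟨g2, hg2, hg2'⟩ := exists_mem_idealGeneratedBy_eTwoZero (d := X (0, 0))
    hinv2 fun b => hX (0, 0) b
  obtain ⟨g3, hg3, hg3'⟩ := exists_mem_idealGeneratedBy_eTwoZero (hinv (X (1, 0) (1, 1))) hinv1
  obtain ⟨g4, hg4, hg4'⟩ := exists_mem_idealGeneratedBy_eTwoZero (hinv (X (1, 0) (0, 0))) hinv2
  -- `g5` fills each row of the middle block with its off-diagonal entry. The rest is diagonal, with
  -- entries (t₁ - t₂) h and its flip, and equals `g6 - g7`: the off-diagonal entries of `g6` and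
  -- `g7` agree.
  obtain ⟨g5, hg5, hg5'⟩ := exists_mem_idealGeneratedBy_eTwoZero (hinv (X (1, 0) (0, 1))) (hinv 1)
  obtain ⟨g6, hg6, hg6'⟩ := exists_mem_idealGeneratedBy_eTwoZero (hinv (h * mono 1 0)) (hinv 1)
  obtain ⟨g7, hg7, hg7'⟩ := exists_mem_idealGeneratedBy_eTwoZero (hinv h) (hinv (mono 0 1))
  have key : f = g1 + g2 + g3 + g4 + g5 + g6 - g7 := by
    refine laurentMatrix_injective ?_
    rw [← hXdef]
    have h1 : X (0, 1) (1, 1) = flip (X (1, 0) (1, 1)) := hX (1, 0) (1, 1)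
    have h2 : X (0, 1) (0, 0) = flip (X (1, 0) (0, 0)) := hX (1, 0) (0, 0)
    have h3 : X (0, 1) (1, 0) = flip (X (1, 0) (0, 1)) := hX (1, 0) (0, 1)
    have h4 : X (0, 1) (0, 1) = flip (X (1, 0) (1, 0)) := hX (1, 0) (1, 0)
    ext a b : 2
    simp only [map_add, map_sub, Matrix.add_apply, Matrix.sub_apply, hg1', hg2', hg3', hg4', hg5',
      hg6', hg7']
    revert a b
    simp only [forall_residuePair]
    simp only [invariantVector, Matrix.cons_val_zero, Matrix.cons_val_one, h1, h2, h3, h4, hF,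
      map_add, map_sub, map_mul, map_zero, map_one, flip_mono]
    refine ⟨⟨?_, ?_, ?_, ?_⟩, ⟨?_, ?_, ?_, ?_⟩, ⟨?_, ?_, ?_, ?_⟩, ?_, ?_, ?_, ?_⟩ <;> ring_nf
  rw [key]
  exact sub_mem (add_mem (add_mem (add_mem (add_mem (add_mem hg1 hg2) hg3) hg4) hg5) hg6) hg7

/-- A linear section of the character, which is compatible with the involutions. -/
theorem exists_section : ∃ s : ℚ[T;T⁻¹] →ₗ[ℚ] AffineSchur 2 2,
    (∀ g, antisymmetricCharacter (s g) = g) ∧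
      ∀ g, transposeMap 2 2 (s g) = s (LaurentPolynomial.invert g) := by
  let D : ℚ[T;T⁻¹] → Matrix ResiduePair ResiduePair LaurentTwo := fun g =>
    -- The diagonal entries are g(t₁) at (1, 0) and g(t₂) at (0, 1). A diagonal matrix is its own
    -- transpose, so τ only inverts the variables.
    Matrix.diagonal (invariantVector 0 (inclLeft g) 0)
  have hD : ∀ g, IsFlipInvariant (D g) := by
    intro g a b
    simp only [D, Matrix.diagonal_apply, Prod.swap_inj]
    rw [apply_ite flip, map_zero, invariantVector_swap (by simp) (by simp)]
  choose s hs using fun g => (hD g).exists_laurentMatrix_eq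
  refine ⟨⟨⟨s, fun g h => laurentMatrix_injective ?_⟩, fun c g => laurentMatrix_injective ?_⟩,
    fun g => ?_, fun g => laurentMatrix_injective ?_⟩
  · rw [map_add, hs, hs, hs]
    simp only [D, Matrix.diagonal_add]
    congr 1
    funext a
    revert a
    rw [forall_residuePair]
    simp [invariantVector]
  · change laurentMatrix (s (c • g)) = laurentMatrix (c • s g)
    rw [map_smul, hs, hs]
    simp only [D, ← Matrix.diagonal_smul]
    congr 1
    funext a
    revert a
    rw [forall_residuePair]
    simp [invariantVector]
  · change antisymmetricCharacter (s g) = g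
    rw [antisymmetricCharacter_apply, hs]
    simp [D, invariantVector, spec_inclLeft]
  · change laurentMatrix (transposeMap 2 2 (s g)) = laurentMatrix (s _)
    ext a b : 2
    rw [laurentMatrix_transposeMap, hs, hs]
    simp only [D, Matrix.diagonal_apply, eq_comm (a := a)]
    rw [apply_ite conj, map_zero]
    split_ifs with h
    · subst h
      revert b
      rw [forall_residuePair]
      simp [invariantVector, ← conj_inclLeft, flip_conj]
    · rfl

theorem antisymmetricCharacter_surjective : Function.Surjective antisymmetricCharacter := by
  obtain ⟨s, hs, -⟩ := exists_section
  exact fun g => ⟨s g, hs g⟩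

/-- The top quotient of the affine Schur algebra. -/
def quotientEquiv : (AffineSchur 2 2 ⧸ idealGeneratedBy eTwoZero) ≃ₐ[ℚ] ℚ[T;T⁻¹] :=
  AlgEquiv.ofBijective
    (Ideal.Quotient.liftₐ _ antisymmetricCharacter fun _ => mem_idealGeneratedBy_eTwoZero.1) (by
      constructor
      · refine (injective_iff_map_eq_zero _).2 fun x hx => ?_
        obtain ⟨a, rfl⟩ := Ideal.Quotient.mk_surjective x
        exact Ideal.Quotient.eq_zero_iff_mem.2 (mem_idealGeneratedBy_eTwoZero.2 hx)
      · intro g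
        obtain ⟨f, hf⟩ := antisymmetricCharacter_surjective g
        exact ⟨Ideal.Quotient.mk _ f, hf⟩)

/-- The range of a linear section complements the kernel of the character, which is S e S. It is
τ-stable because the section intertwines τ with T ↦ T⁻¹. -/
theorem exists_stable_complement : ∃ N : Submodule ℚ (AffineSchur 2 2),
    IsCompl ((idealGeneratedBy eTwoZero).restrictScalars ℚ) N ∧
      N.map (transposeMap 2 2) = N := by
  obtain ⟨s, hs, hs'⟩ := exists_section
  refine ⟨LinearMap.range s, IsCompl.of_eq ?_ ?_,
    isInvolution_transposeMap.map_eq_of_map_mem ?_⟩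
  · refine (Submodule.eq_bot_iff _).2 ?_
    rintro _ ⟨h1, g, rfl⟩
    have h2 := mem_idealGeneratedBy_eTwoZero.1 h1
    rw [hs] at h2
    rw [h2, map_zero]
  · refine (Submodule.eq_top_iff').2 fun f => ?_
    rw [← sub_add_cancel f (s (antisymmetricCharacter f))]
    refine Submodule.add_mem_sup (mem_idealGeneratedBy_eTwoZero.2 ?_) ⟨_, rfl⟩
    rw [map_sub, hs, sub_self]
  · rintro _ ⟨g, rfl⟩
    exact ⟨_, (hs' g).symm⟩

end AffineSchur

end

/-! ### The main theorem -/

theorem theorem4p6 :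
    -- the algebra with the transpose involution is affine cellular
    IsAffineCellular (AffineSchur.transposeMap 2 2) ∧
    -- the cell chain `0 ⊂ J ⊂ S`, where `J = S e_λ S` with `λ = (2, 0)`
    ⊥ < idealGeneratedBy (AffineSchur.e (AffineSchur.diag AffineSchur.twoZero)) ∧
    idealGeneratedBy (AffineSchur.e (AffineSchur.diag AffineSchur.twoZero)) < ⊤ ∧
    IsAffineCellChain (AffineSchur.transposeMap 2 2) (m := 2)
      ![⊥, idealGeneratedBy (AffineSchur.e (AffineSchur.diag AffineSchur.twoZero)), ⊤] ∧
    -- `J` is an affine cell ideal with `V` of rank four and `B = ℚ[x₂, x₂⁻¹][x₁]`, which is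
    -- identified through `ι` with `e_λ S e_λ` and its involution, the restriction of the transpose
    (∃ (V : Type) (_ : AddCommGroup V) (_ : Module ℚ V)
      (σ : ℚ[T;T⁻¹][X] →ₗ[ℚ] ℚ[T;T⁻¹][X]) (ι : ℚ[T;T⁻¹][X] →ₙₐ[ℚ] AffineSchur 2 2),
      Module.finrank ℚ V = 4 ∧
      Function.Injective ι ∧
      Set.range ι = {x | ∃ a, x = AffineSchur.e (AffineSchur.diag AffineSchur.twoZero) * a *
        AffineSchur.e (AffineSchur.diag AffineSchur.twoZero)} ∧
      (∀ b, ι (σ b) = AffineSchur.transposeMap 2 2 (ι b)) ∧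
      IsAffineCellIdealWith (AffineSchur.transposeMap 2 2)
        (idealGeneratedBy (AffineSchur.e (AffineSchur.diag AffineSchur.twoZero)))
        V ℚ[T;T⁻¹][X] σ) ∧
    -- the top quotient is a Laurent polynomial ring, and it is affine cellular
    Nonempty ((AffineSchur 2 2 ⧸
        idealGeneratedBy (AffineSchur.e (AffineSchur.diag AffineSchur.twoZero))) ≃ₐ[ℚ]
      ℚ[T;T⁻¹]) ∧
    (∃ τ' : (AffineSchur 2 2 ⧸
        idealGeneratedBy (AffineSchur.e (AffineSchur.diag AffineSchur.twoZero))) →ₗ[ℚ]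
        (AffineSchur 2 2 ⧸
        idealGeneratedBy (AffineSchur.e (AffineSchur.diag AffineSchur.twoZero))),
      IsInducedOnQuotient (AffineSchur.transposeMap 2 2)
        (idealGeneratedBy (AffineSchur.e (AffineSchur.diag AffineSchur.twoZero))) τ' ∧
      IsAffineCellular τ') := by
  obtain ⟨σ, ι, hinj, hrange, hισ, hcell⟩ := AffineSchur.exists_isAffineCellIdealWith
  obtain ⟨N, hN, hτN⟩ := AffineSchur.exists_stable_complement
  have hchain := hcell.isAffineCellChain AffineSchur.quotientEquiv.symm hN hτN
  obtain ⟨τ', h1, h2⟩ := AffineSchur.isInvolution_transposeMap.exists_induced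
    (idealGeneratedBy AffineSchur.eTwoZero) fun _ hx =>
      AffineSchur.isInvolution_transposeMap.map_mem_idealGeneratedBy
        AffineSchur.transposeMap_eTwoZero hx
  refine ⟨⟨AffineSchur.isInvolution_transposeMap, 2, _, hchain⟩, ?_, ?_, hchain,
    ⟨Fin 4 → ℚ, inferInstance, inferInstance, σ, ι, by simp, hinj, hrange, hισ, hcell⟩,
    ⟨AffineSchur.quotientEquiv⟩,
    ⟨τ', h1, isAffineCellular_of_equiv h2 AffineSchur.quotientEquiv.symm⟩⟩
  -- J contains the nonzero matrix unit e, and it omits 1 because the character sends 1 to 1.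
  · refine bot_lt_iff_ne_bot.2 fun h => ?_
    have h0 := mem_idealGeneratedBy_self AffineSchur.eTwoZero
    rw [h, Ideal.mem_bot] at h0
    have h3 := AffineSchur.laurentMatrix_e_twoZero
    rw [show AffineSchur.e (AffineSchur.diag AffineSchur.twoZero) = 0 from h0, map_zero] at h3
    simpa using congrFun (congrFun h3 (1, 1)) (1, 1)
  · refine lt_top_iff_ne_top.2 fun h => ?_
    have h0 := AffineSchur.mem_idealGeneratedBy_eTwoZero.1 ((Ideal.eq_top_iff_one _).1 h)
    rw [map_one] at h0
    exact one_ne_zero h0
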